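/- Let $N$ be a $\mathrm{II}_1$ factor, i.e. an infinite-dimensional von Neumann algebra with trivial center that carries a faithful normal tracial state $\tau$, and put $\|x\|_2=\tau(x^*x)^{1/2}$ for $x\in N$. Let $\sigma:\Gamma\curvearrowright N$ be an action of a discrete group $\Gamma$ by $*$-automorphisms. Suppose that for every (operator-norm) bounded net $(x_i)_{i\in I}$ in $N$ which satisfies $\lim_i\|x_ia-ax_i\|_2=0$ for all $a\in N$ and $\lim_i\|\sigma_g(x_i)-x_i\|_2=0$ for all $g\in\Gamma$, we have $\lim_i\|x_i-\tau(x_i)1\|_2=0$. Then there exist a finite set $S\subset\mathcal U(N)$ of unitaries of $N$, a finite set $K\subset\Gamma$ and a constant $\kappa>0$ such that for all $x\in N$ \[ \|x-\tau(x)1\|_2\le\kappa\Big(\sum_{u\in S}\|ux-xu\|_2+\sum_{g\in K}\|\sigma_g(x)-x\|_2\Big). \] -/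

import Mathlib

universe u v

open Filter Topology
open scoped ComplexOrder

/-- The von Neumann algebra `N` on the Hilbert space `H` is a factor: its center consists of the
scalar multiples of the identity. -/
def VonNeumannAlgebra.IsFactor {H : Type*} [NormedAddCommGroup H] [InnerProductSpace ℂ H]
    [CompleteSpace H] (N : VonNeumannAlgebra H) : Prop :=
  ∀ z : N.toStarSubalgebra, (∀ a : N.toStarSubalgebra, a * z = z * a) → ∃ c : ℂ, z = c • 1

/-- `τ` is a faithful normal tracial state on the von Neumann algebra `N`. Here `N` carries the
Loewner order inherited from the bounded operators on `H`, and normality means that `τ` preserves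
suprema of (bounded) upward directed families of positive elements of `N`. -/
structure IsFaithfulNormalTracialState {H : Type*} [NormedAddCommGroup H]
    [InnerProductSpace ℂ H] [CompleteSpace H] (N : VonNeumannAlgebra H)
    (τ : N.toStarSubalgebra →ₗ[ℂ] ℂ) : Prop where
  map_one : τ 1 = 1
  nonneg : ∀ x, 0 ≤ τ (star x * x)
  tracial : ∀ x y, τ (x * y) = τ (y * x)
  faithful : ∀ x, τ (star x * x) = 0 → x = 0
  normal : ∀ (D : Set N.toStarSubalgebra) (a : N.toStarSubalgebra), D.Nonempty →
    DirectedOn (· ≤ ·) D → (∀ d ∈ D, 0 ≤ d) → IsLUB D a →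
    IsLUB ((fun d => (τ d).re) '' D) (τ a).re

/-- `N` is a II₁ factor and `τ` is its trace: `N` is an infinite-dimensional factor and `τ` is a
faithful normal tracial state on it. -/
structure IsIIOneFactor {H : Type*} [NormedAddCommGroup H]
    [InnerProductSpace ℂ H] [CompleteSpace H] (N : VonNeumannAlgebra H)
    (τ : N.toStarSubalgebra →ₗ[ℂ] ℂ) : Prop where
  factor : N.IsFactor
  infinite_dimensional : ¬ FiniteDimensional ℂ N.toStarSubalgebra
  trace : IsFaithfulNormalTracialState N τ

/-- The 2-norm `‖x‖₂ = τ(x* x)^{1/2}` of a state `τ`. -/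
noncomputable def twoNorm {H : Type*} [NormedAddCommGroup H]
    [InnerProductSpace ℂ H] [CompleteSpace H] {N : VonNeumannAlgebra H}
    (τ : N.toStarSubalgebra →ₗ[ℂ] ℂ) (x : N.toStarSubalgebra) : ℝ :=
  Real.sqrt (τ (star x * x)).re

/-!
If the inequality fails, there are self-adjoint `x` with `τ x = 0` and `‖x‖₂ = 1` which are almost
fixed in 2-norm by any given finite set of the `σ g` and of inner automorphisms. Truncations of `x`
are bounded, hence nearly scalar by the hypothesis on nets, so most of the mass of `x` sits at large
heights. Slicing `|x|` at the heights `(1 + η) ^ k`, as in Namioka's trick, produces functions of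
`x` which are almost projections of arbitrarily small trace and move little relative to their own
2-norm. If `q` is such an almost projection and `y` is one which almost commutes with `√(1 - q)`,
then `q + √(1 - q) y² √(1 - q)` is a larger one, with no loss in the relative errors; by Zorn's
lemma there is one of trace between `1 / 8` and `1 / 4`. It has bounded norm and is almost fixed,
but far from the scalars, which contradicts the hypothesis.
-/

/-! ### The 2-norm of a positive functional -/

section L2Norm

variable {A : Type*} [CStarAlgebra A] [PartialOrder A]

/-- The seminorm `‖x‖₂ = τ(x* x)^{1/2}` of a positive functional `τ` on a C⋆-algebra. It is the
norm of the pre-GNS space `τ.PreGNS`, pulled back along `τ.toPreGNS`. -/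
noncomputable def l2Norm (τ : A →ₚ[ℂ] ℂ) (x : A) : ℝ :=
  √(τ (star x * x)).re

variable (τ : A →ₚ[ℂ] ℂ)

lemma l2Norm_nonneg (x : A) : 0 ≤ l2Norm τ x := Real.sqrt_nonneg _

lemma l2Norm_zero : l2Norm τ 0 = 0 := by simp [l2Norm]

lemma l2Norm_neg (x : A) : l2Norm τ (-x) = l2Norm τ x := by simp [l2Norm]

lemma l2Norm_sub_comm (x y : A) : l2Norm τ (x - y) = l2Norm τ (y - x) := by
  rw [← neg_sub, l2Norm_neg]

lemma re_map_nonneg {x : A} (hx : 0 ≤ x) : 0 ≤ (τ x).re :=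
  (Complex.nonneg_iff.mp (τ.map_nonneg hx)).1

lemma re_map_mono {x y : A} (hxy : x ≤ y) : (τ x).re ≤ (τ y).re :=
  (Complex.le_def.mp (OrderHomClass.mono τ hxy)).1

variable [StarOrderedRing A]

lemma l2Norm_sq (x : A) : l2Norm τ x ^ 2 = (τ (star x * x)).re :=
  Real.sq_sqrt (re_map_nonneg τ (star_mul_self_nonneg x))

lemma l2Norm_sq_of_isSelfAdjoint {x : A} (hx : IsSelfAdjoint x) :
    l2Norm τ x ^ 2 = (τ (x * x)).re := by
  rw [l2Norm_sq, hx.star_eq]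

lemma l2Norm_add_le (x y : A) : l2Norm τ (x + y) ≤ l2Norm τ x + l2Norm τ y :=
  norm_add_le (τ.toPreGNS x) (τ.toPreGNS y)

lemma l2Norm_sub_le (x y : A) : l2Norm τ (x - y) ≤ l2Norm τ x + l2Norm τ y :=
  norm_sub_le (τ.toPreGNS x) (τ.toPreGNS y)

lemma l2Norm_smul (c : ℂ) (x : A) : l2Norm τ (c • x) = ‖c‖ * l2Norm τ x :=
  norm_smul c (τ.toPreGNS x)

lemma norm_map_star_mul_le (x y : A) : ‖τ (star x * y)‖ ≤ l2Norm τ x * l2Norm τ y :=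
  norm_inner_le_norm (𝕜 := ℂ) (τ.toPreGNS x) (τ.toPreGNS y)

lemma l2Norm_mul_le (a x : A) : l2Norm τ (a * x) ≤ ‖a‖ * l2Norm τ x :=
  ((τ.leftMulMapPreGNS a).le_opNorm (τ.toPreGNS x)).trans <|
    mul_le_mul_of_nonneg_right (LinearMap.mkContinuous_norm_le _ (norm_nonneg a) _)
      (l2Norm_nonneg τ x)

lemma l2Norm_mul_le_of_norm_le_one {a : A} (ha : ‖a‖ ≤ 1) (x : A) :
    l2Norm τ (a * x) ≤ l2Norm τ x :=
  (l2Norm_mul_le τ a x).trans (mul_le_of_le_one_left (l2Norm_nonneg τ x) ha)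

end L2Norm

/-- A positive functional on a C⋆-algebra is a tracial state. -/
structure IsTracialState {A : Type*} [CStarAlgebra A] [PartialOrder A] (τ : A →ₚ[ℂ] ℂ) :
    Prop where
  protected map_one : τ 1 = 1
  map_mul_comm : ∀ x y, τ (x * y) = τ (y * x)

namespace IsTracialState

variable {A : Type*} [CStarAlgebra A] [PartialOrder A] {τ : A →ₚ[ℂ] ℂ}

lemma l2Norm_star (h : IsTracialState τ) (x : A) : l2Norm τ (star x) = l2Norm τ x := by
  rw [l2Norm, l2Norm, star_star, h.map_mul_comm]

lemma l2Norm_one (h : IsTracialState τ) : l2Norm τ (1 : A) = 1 := by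
  simp [l2Norm, h.map_one]

lemma nontrivial (h : IsTracialState τ) : Nontrivial A :=
  ⟨0, 1, fun h01 => by simpa [← h01] using h.map_one⟩

lemma norm_unitary_le (h : IsTracialState τ) (u : unitary A) : ‖(u : A)‖ ≤ 1 :=
  have := h.nontrivial
  (CStarRing.norm_coe_unitary u).le

variable [StarOrderedRing A]

lemma re_mul_nonneg (h : IsTracialState τ) {x y : A} (hx : 0 ≤ x) (hy : 0 ≤ y) :
    0 ≤ (τ (x * y)).re := by
  obtain ⟨c, rfl⟩ := CStarAlgebra.nonneg_iff_eq_star_mul_self.mp hy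
  rw [← mul_assoc, h.map_mul_comm, ← mul_assoc]
  exact re_map_nonneg τ (star_right_conjugate_nonneg hx c)

lemma re_mul_mono (h : IsTracialState τ) {x y z : A} (hx : 0 ≤ x) (hyz : y ≤ z) :
    (τ (x * y)).re ≤ (τ (x * z)).re := by
  simpa [mul_sub] using h.re_mul_nonneg hx (sub_nonneg.mpr hyz)

lemma abs_re_mul_le (h : IsTracialState τ) (x y : A) :
    |(τ (x * y)).re| ≤ l2Norm τ x * l2Norm τ y := by
  have hCS := norm_map_star_mul_le τ (star x) y
  rw [star_star, h.l2Norm_star] at hCS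
  exact (Complex.abs_re_le_norm _).trans hCS

lemma l2Norm_mul_le_right (h : IsTracialState τ) (x a : A) :
    l2Norm τ (x * a) ≤ l2Norm τ x * ‖a‖ := by
  rw [← h.l2Norm_star, star_mul, mul_comm, ← h.l2Norm_star x, ← norm_star a]
  exact l2Norm_mul_le τ _ _

lemma l2Norm_mul_le_of_norm_le_one_right (h : IsTracialState τ) {a : A} (ha : ‖a‖ ≤ 1) (x : A) :
    l2Norm τ (x * a) ≤ l2Norm τ x :=
  (h.l2Norm_mul_le_right x a).trans (mul_le_of_le_one_right (l2Norm_nonneg τ x) ha)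

lemma l2Norm_unitary_conj_sub (h : IsTracialState τ) (u : unitary A) (x : A) :
    l2Norm τ ((u : A) * x * star (u : A) - x) = l2Norm τ ((u : A) * x - x * u) := by
  have hu : ‖(u : A)‖ ≤ 1 := h.norm_unitary_le u
  refine le_antisymm ?_ ?_
  · have e : (u : A) * x * star (u : A) - x = ((u : A) * x - x * u) * star (u : A) := by
      rw [sub_mul, mul_assoc x, Unitary.mul_star_self_of_mem u.2, mul_one]
    rw [e]
    exact h.l2Norm_mul_le_of_norm_le_one_right ((norm_star _).trans_le hu) _
  · have e : (u : A) * x - x * u = ((u : A) * x * star (u : A) - x) * u := by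
      rw [sub_mul, mul_assoc _ (star (u : A)), Unitary.star_mul_self_of_mem u.2, mul_one]
    rw [e]
    exact h.l2Norm_mul_le_of_norm_le_one_right hu _

lemma l2Norm_sq_le_re (h : IsTracialState τ) {x : A} (h0 : 0 ≤ x) (h1 : x ≤ 1) :
    l2Norm τ x ^ 2 ≤ (τ x).re := by
  rw [l2Norm_sq_of_isSelfAdjoint τ (.of_nonneg h0)]
  simpa using h.re_mul_mono h0 h1

end IsTracialState

/-! ### Joint functional calculus under a trace -/

lemma abs_le_norm_of_mem_spectrum {A : Type*} [CStarAlgebra A] {a : A} {s : ℝ}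
    (hs : s ∈ spectrum ℝ a) : |s| ≤ ‖a‖ := by
  rcases subsingleton_or_nontrivial A with hA | hA
  · simp [spectrum.of_subsingleton] at hs
  · exact spectrum.norm_le_norm_of_mem hs

section Bernstein

/-- The Bernstein polynomials of degree `n`, transported from `[0, 1]` to `[-R, R]` and extended
by constants to the real line. -/
noncomputable def bernsteinWeight (R : ℝ) (n : ℕ) (k : Fin (n + 1)) (s : ℝ) : ℝ :=
  bernstein n k (Set.projIcc 0 1 zero_le_one ((s / R + 1) / 2))

/-- The node of `[-R, R]` that carries the weight `bernsteinWeight R n k`. -/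
noncomputable def bernsteinNode (R : ℝ) {n : ℕ} (k : Fin (n + 1)) : ℝ :=
  R * (2 * (bernstein.z k : ℝ) - 1)

lemma continuous_bernsteinWeight (R : ℝ) {n : ℕ} (k : Fin (n + 1)) :
    Continuous (bernsteinWeight R n k) := by
  unfold bernsteinWeight
  fun_prop

lemma bernsteinWeight_nonneg (R : ℝ) {n : ℕ} (k : Fin (n + 1)) (s : ℝ) :
    0 ≤ bernsteinWeight R n k s := bernstein_nonneg

lemma tendstoUniformlyOn_sum_bernsteinWeight {R : ℝ} (hR : 0 < R) {φ : ℝ → ℝ}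
    (hφ : Continuous φ) :
    TendstoUniformlyOn (fun n s => ∑ k, φ (bernsteinNode R k) * bernsteinWeight R n k s) φ atTop
      (Set.Icc (-R) R) := by
  let ψ : C(unitInterval, ℝ) := ⟨fun z => φ (R * (2 * (z : ℝ) - 1)), by fun_prop⟩
  have hψ := ContinuousMap.tendsto_iff_tendstoUniformly.mp (bernsteinApproximation_uniform ψ)
  refine ((hψ.comp fun s => Set.projIcc 0 1 zero_le_one ((s / R + 1) / 2)).tendstoUniformlyOn
    (s := Set.Icc (-R) R)).congr (.of_forall fun n s _ => ?_) |>.congr_right fun s hs => ?_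
  · simp [bernsteinApproximation.apply, ψ, bernsteinNode, bernsteinWeight, mul_comm]
  · have hmem : (s / R + 1) / 2 ∈ Set.Icc (0 : ℝ) 1 := by
      have h1 : -1 ≤ s / R := by rw [le_div_iff₀ hR]; linarith [hs.1]
      have h2 : s / R ≤ 1 := by rw [div_le_iff₀ hR]; linarith [hs.2]
      constructor <;> linarith
    simp only [Function.comp_apply, ψ, ContinuousMap.coe_mk, Set.projIcc_of_mem _ hmem]
    congr 1
    field_simp
    ring

lemma tendsto_sum_smul_cfc_bernsteinWeight {A : Type*} [CStarAlgebra A] {R : ℝ} (hR : 0 < R)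
    {φ : ℝ → ℝ} (hφ : Continuous φ) {a : A} (haR : ‖a‖ ≤ R) :
    Tendsto (fun n => ∑ k, φ (bernsteinNode R k) • cfc (bernsteinWeight R n k) a) atTop
      (𝓝 (cfc φ a)) := by
  have hspec : spectrum ℝ a ⊆ Set.Icc (-R) R := fun s hs =>
    abs_le.mp ((abs_le_norm_of_mem_spectrum hs).trans haR)
  have hlim := tendsto_cfc_fun (a := a) ((tendstoUniformlyOn_sum_bernsteinWeight hR hφ).mono hspec)
    (.of_forall fun n => (continuous_finsetSum _ fun k _ =>
      continuous_const.mul (continuous_bernsteinWeight R k)).continuousOn)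
  refine hlim.congr fun n => ?_
  have hsum := cfc_sum_univ (fun k s => φ (bernsteinNode R k) * bernsteinWeight R n k s) a fun k =>
    (continuous_const.mul (continuous_bernsteinWeight R k)).continuousOn
  simp only [cfc_const_mul _ _ a (continuous_bernsteinWeight R _).continuousOn] at hsum
  rw [← hsum]
  congr 1
  ext s
  simp

end Bernstein

lemma re_map_smul {A : Type*} [CStarAlgebra A] [PartialOrder A] (τ : A →ₚ[ℂ] ℂ) (r : ℝ) (x : A) :
    (τ (r • x)).re = r * (τ x).re := by
  rw [← Complex.coe_smul, map_smul, smul_eq_mul, Complex.re_ofReal_mul]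

namespace IsTracialState

variable {A : Type*} [CStarAlgebra A] [PartialOrder A] [StarOrderedRing A] {τ : A →ₚ[ℂ] ℂ}

/-- The pairings `τ(φ(a) ψ(b))` define a positive measure on `ℝ²`, here approached by its values on
products of Bernstein weights. -/
theorem sum_re_cfc_mul_cfc_nonneg (h : IsTracialState τ) {ι : Type*} (I : Finset ι)
    {f g : ι → ℝ → ℝ} (hf : ∀ i, Continuous (f i)) (hg : ∀ i, Continuous (g i))
    (hfg : ∀ s t, 0 ≤ ∑ i ∈ I, f i s * g i t) (a b : A) :
    0 ≤ ∑ i ∈ I, (τ (cfc (f i) a * cfc (g i) b)).re := by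
  obtain ⟨R, hR⟩ := exists_gt (max ‖a‖ ‖b‖)
  have haR : ‖a‖ ≤ R := (le_max_left _ _).trans hR.le
  have hbR : ‖b‖ ≤ R := (le_max_right _ _).trans hR.le
  have hR0 : 0 < R := (norm_nonneg a).trans_lt ((le_max_left _ _).trans_lt hR)
  have hlim : Tendsto (fun n => ∑ i ∈ I,
      (τ ((∑ k, f i (bernsteinNode R k) • cfc (bernsteinWeight R n k) a) *
        ∑ l, g i (bernsteinNode R l) • cfc (bernsteinWeight R n l) b)).re) atTop
      (𝓝 (∑ i ∈ I, (τ (cfc (f i) a * cfc (g i) b)).re)) :=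
    tendsto_finsetSum _ fun i _ => ((Complex.continuous_re.comp (map_continuous τ)).tendsto _).comp
      ((tendsto_sum_smul_cfc_bernsteinWeight hR0 (hf i) haR).mul
        (tendsto_sum_smul_cfc_bernsteinWeight hR0 (hg i) hbR))
  refine ge_of_tendsto' hlim fun n => ?_
  simp only [Finset.sum_mul_sum, smul_mul_smul_comm, map_sum, Complex.re_sum, re_map_smul]
  rw [Finset.sum_comm]
  refine Finset.sum_nonneg fun k _ => ?_
  rw [Finset.sum_comm]
  refine Finset.sum_nonneg fun l _ => ?_
  rw [← Finset.sum_mul]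
  exact mul_nonneg (hfg _ _) (h.re_mul_nonneg
    (cfc_nonneg fun s _ => bernsteinWeight_nonneg R k s)
    (cfc_nonneg fun s _ => bernsteinWeight_nonneg R l s))

lemma mul_l2Norm_cfc_sub_cfc_sq (h : IsTracialState τ) (c : ℝ) {f : ℝ → ℝ} (hf : Continuous f)
    {a b : A} (ha : IsSelfAdjoint a) (hb : IsSelfAdjoint b) :
    c * l2Norm τ (cfc f a - cfc f b) ^ 2 =
      ∑ k : Fin 3, (τ (cfc (![fun s => c * f s ^ 2, fun s => -2 * c * f s, fun _ => c] k) a *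
        cfc (![fun _ => 1, f, fun s => f s ^ 2] k) b)).re := by
  have hsq : ∀ x : A, IsSelfAdjoint x → cfc (fun s => f s ^ 2) x = cfc f x * cfc f x :=
    fun x hx => by rw [cfc_pow f 2 x hf.continuousOn hx, pow_two]
  have hcomm := h.map_mul_comm (cfc f b) (cfc f a)
  rw [l2Norm_sq_of_isSelfAdjoint τ ((cfc_predicate f a).sub (cfc_predicate f b))]
  simp only [Fin.sum_univ_three, Matrix.cons_val, cfc_const_mul _ f _ hf.continuousOn,
    cfc_const_mul _ (fun s => f s ^ 2) _ (hf.pow 2).continuousOn, hsq a ha, hsq b hb,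
    cfc_const_one ℝ b, cfc_const c a, Algebra.algebraMap_eq_smul_one, smul_mul_assoc, one_mul,
    mul_one, re_map_smul, sub_mul, mul_sub, map_sub, Complex.sub_re, hcomm]
  ring

lemma sum_mul_l2Norm_cfc_sub_cfc_sq_nonneg (h : IsTracialState τ) {ι : Type*} (I : Finset ι)
    (c : ι → ℝ) {f : ι → ℝ → ℝ} (hf : ∀ i, Continuous (f i))
    (hfs : ∀ s t, 0 ≤ ∑ i ∈ I, c i * (f i s - f i t) ^ 2) {a b : A} (ha : IsSelfAdjoint a)
    (hb : IsSelfAdjoint b) :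
    0 ≤ ∑ i ∈ I, c i * l2Norm τ (cfc (f i) a - cfc (f i) b) ^ 2 := by
  simp only [h.mul_l2Norm_cfc_sub_cfc_sq _ (hf _) ha hb]
  rw [← Finset.sum_product']
  refine h.sum_re_cfc_mul_cfc_nonneg (I ×ˢ Finset.univ)
    (f := fun p : ι × Fin 3 => ![fun s => c p.1 * f p.1 s ^ 2, fun s => -2 * c p.1 * f p.1 s,
      fun _ => c p.1] p.2)
    (g := fun p => ![fun _ => 1, f p.1, fun s => f p.1 s ^ 2] p.2)
    (fun ⟨i, k⟩ => ?_) (fun ⟨i, k⟩ => ?_) (fun s t => ?_) a b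
  · match k with
    | 0 => exact continuous_const.mul ((hf i).pow 2)
    | 1 => exact continuous_const.mul (hf i)
    | 2 => exact continuous_const
  · match k with
    | 0 => exact continuous_const
    | 1 => exact hf i
    | 2 => exact (hf i).pow 2
  · refine (hfs s t).trans_eq ?_
    rw [Finset.sum_product]
    refine Finset.sum_congr rfl fun i _ => ?_
    simp only [Fin.sum_univ_three, Matrix.cons_val]
    ring

theorem sum_l2Norm_cfc_sub_cfc_sq_le (h : IsTracialState τ) {ι : Type*} (I : Finset ι)
    {f : ι → ℝ → ℝ} (hf : ∀ i, Continuous (f i))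
    (hfs : ∀ s t, ∑ i ∈ I, (f i s - f i t) ^ 2 ≤ (s - t) ^ 2) {a b : A} (ha : IsSelfAdjoint a)
    (hb : IsSelfAdjoint b) :
    ∑ i ∈ I, l2Norm τ (cfc (f i) a - cfc (f i) b) ^ 2 ≤ l2Norm τ (a - b) ^ 2 := by
  have hnonneg := h.sum_mul_l2Norm_cfc_sub_cfc_sq_nonneg (Finset.insertNone I)
    (fun o => o.elim 1 fun _ => -1) (f := fun o => o.elim id f)
    (by rintro (_ | i); exacts [continuous_id, hf i])
    (by intro s t; simpa [Finset.sum_insertNone] using hfs s t) ha hb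
  simpa [Finset.sum_insertNone, cfc_id ℝ a, cfc_id ℝ b] using hnonneg

end IsTracialState

/-! ### Namioka's trick -/

/-- Truncation of `|s|` at height `(1 + η) ^ k`. -/
noncomputable def trunc (η : ℝ) (k : ℕ) (s : ℝ) : ℝ := min |s| ((1 + η) ^ k)

/-- The length of the interval from `(1 + η) ^ k` to `(1 + η) ^ (k + 1)`. -/
noncomputable def rampWidth (η : ℝ) (k : ℕ) : ℝ := η * (1 + η) ^ k

/-- The piecewise linear function of `|s|` climbing from `0` at `(1 + η) ^ k` to `1` at
`(1 + η) ^ (k + 1)`. -/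
noncomputable def ramp (η : ℝ) (k : ℕ) (s : ℝ) : ℝ :=
  (trunc η (k + 1) s - trunc η k s) / rampWidth η k

section Ramp

variable {η : ℝ}

@[fun_prop]
lemma continuous_trunc (k : ℕ) : Continuous (trunc η k) := by unfold trunc; fun_prop

@[fun_prop]
lemma continuous_ramp (k : ℕ) : Continuous (ramp η k) :=
  ((continuous_trunc _).sub (continuous_trunc _)).div_const _

lemma trunc_zero (s : ℝ) : trunc η 0 s = min |s| 1 := by rw [trunc, pow_zero]

lemma trunc_mono {s t : ℝ} (hst : |s| ≤ |t|) (k : ℕ) : trunc η k s ≤ trunc η k t :=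
  min_le_min_right _ hst

lemma trunc_sub_trunc_le {s t : ℝ} (hst : |t| ≤ |s|) (k : ℕ) :
    trunc η k s - trunc η k t ≤ |s| - |t| := by
  unfold trunc
  rcases le_total |t| ((1 + η) ^ k) with h | h
  · rw [min_eq_left h]
    linarith [min_le_left |s| ((1 + η) ^ k)]
  · rw [min_eq_right h, min_eq_right (h.trans hst)]
    linarith

lemma one_add_pow_succ (k : ℕ) : (1 + η) ^ (k + 1) = (1 + η) ^ k + rampWidth η k := by
  rw [rampWidth]; ring

variable (hη : 0 < η)
include hη

lemma rampWidth_pos (k : ℕ) : 0 < rampWidth η k := by unfold rampWidth; positivity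

lemma rampWidth_mul_ramp (k : ℕ) (s : ℝ) :
    rampWidth η k * ramp η k s = trunc η (k + 1) s - trunc η k s :=
  mul_div_cancel₀ _ (rampWidth_pos hη k).ne'

lemma ramp_eq_zero {k : ℕ} {s : ℝ} (hs : |s| ≤ (1 + η) ^ k) : ramp η k s = 0 := by
  have hw := rampWidth_pos hη k
  rw [ramp, trunc, trunc, min_eq_left hs, one_add_pow_succ, min_eq_left (by linarith), sub_self,
    zero_div]

lemma ramp_eq_one {k : ℕ} {s : ℝ} (hs : (1 + η) ^ (k + 1) ≤ |s|) : ramp η k s = 1 := by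
  have hw := rampWidth_pos hη k
  have hpow := one_add_pow_succ (η := η) k
  rw [ramp, trunc, trunc, min_eq_right hs, min_eq_right (by linarith), hpow, add_sub_cancel_left,
    div_self hw.ne']

lemma ramp_nonneg (k : ℕ) (s : ℝ) : 0 ≤ ramp η k s := by
  have hw := rampWidth_pos hη k
  refine div_nonneg (sub_nonneg.mpr (min_le_min_left _ ?_)) hw.le
  linarith [one_add_pow_succ (η := η) k]

lemma ramp_mono {s t : ℝ} (hst : |s| ≤ |t|) (k : ℕ) : ramp η k s ≤ ramp η k t := by
  rcases le_total |s| ((1 + η) ^ k) with h | h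
  · rw [ramp_eq_zero hη h]
    exact ramp_nonneg hη _ _
  · refine div_le_div_of_nonneg_right ?_ (rampWidth_pos hη k).le
    rw [trunc.eq_1 η k, trunc.eq_1 η k, min_eq_right h, min_eq_right (h.trans hst)]
    exact sub_le_sub_right (trunc_mono hst _) _

lemma ramp_le_one (k : ℕ) (s : ℝ) : ramp η k s ≤ 1 := by
  rcases le_total |s| ((1 + η) ^ (k + 1)) with h | h
  · have htop : (0 : ℝ) ≤ (1 + η) ^ (k + 1) := by positivity
    exact (ramp_mono hη (h.trans_eq (abs_of_nonneg htop).symm) k).trans_eq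
      (ramp_eq_one hη (abs_of_nonneg htop).ge)
  · exact (ramp_eq_one hη h).le

lemma ramp_succ_le_sq (k : ℕ) (s : ℝ) : ramp η (k + 1) s ≤ ramp η k s * ramp η k s := by
  rcases le_total |s| ((1 + η) ^ (k + 1)) with h | h
  · rw [ramp_eq_zero hη h]
    exact mul_self_nonneg _
  · rw [ramp_eq_one hη h, one_mul]
    exact ramp_le_one hη _ _

lemma ramp_le_trunc_zero_sq (k : ℕ) (s : ℝ) : ramp η k s ≤ trunc η 0 s * trunc η 0 s := by
  have hpow : 1 ≤ (1 + η) ^ k := one_le_pow₀ (by linarith)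
  rcases le_total |s| 1 with h | h
  · rw [ramp_eq_zero hη (h.trans hpow)]
    exact mul_self_nonneg _
  · rw [trunc_zero, min_eq_right h, one_mul]
    exact ramp_le_one hη _ _

lemma sum_rampWidth_mul_ramp (M : ℕ) (s : ℝ) :
    ∑ k ∈ Finset.range M, rampWidth η k * ramp η k s = trunc η M s - trunc η 0 s := by
  simp only [rampWidth_mul_ramp hη, Finset.sum_range_sub (fun k => trunc η k s)]

lemma sum_ramp_sub_sq_le (M : ℕ) (s t : ℝ) :
    ∑ k ∈ Finset.range M, (rampWidth η k * ramp η k s - rampWidth η k * ramp η k t) ^ 2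
      ≤ (s - t) ^ 2 := by
  wlog hst : |t| ≤ |s| generalizing s t
  · simpa only [sub_sq_comm] using this t s (le_of_not_ge hst)
  have hnonneg : ∀ k ∈ Finset.range M,
      0 ≤ rampWidth η k * ramp η k s - rampWidth η k * ramp η k t := fun k _ =>
    sub_nonneg.mpr (mul_le_mul_of_nonneg_left (ramp_mono hη hst k) (rampWidth_pos hη k).le)
  refine (Finset.sum_sq_le_sq_sum_of_nonneg hnonneg).trans ?_
  rw [← sq_abs (s - t)]
  refine pow_le_pow_left₀ (Finset.sum_nonneg hnonneg) ?_ 2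
  rw [Finset.sum_sub_distrib, sum_rampWidth_mul_ramp hη, sum_rampWidth_mul_ramp hη]
  linarith [abs_sub_abs_le_abs_sub s t, trunc_mono (η := η) hst 0,
    trunc_sub_trunc_le (η := η) hst M]

lemma trunc_sq_le (M : ℕ) (s : ℝ) :
    trunc η M s * trunc η M s ≤ trunc η 0 s * trunc η 0 s +
      ∑ k ∈ Finset.range M, (2 + η) / η * rampWidth η k ^ 2 * ramp η k s := by
  induction M with
  | zero => simp
  | succ M ih =>
    rw [Finset.sum_range_succ]
    have hdiff := rampWidth_mul_ramp hη M s
    have hle : trunc η (M + 1) s + trunc η M s ≤ (1 + η) ^ (M + 1) + (1 + η) ^ M :=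
      add_le_add (min_le_right _ _) (min_le_right _ _)
    have hstep : (2 + η) / η * rampWidth η M ^ 2 * ramp η M s =
        (rampWidth η M * ramp η M s) * ((1 + η) ^ (M + 1) + (1 + η) ^ M) := by
      rw [rampWidth]; field_simp; ring
    have hmul := mul_le_mul_of_nonneg_left hle
      (mul_nonneg (rampWidth_pos hη M).le (ramp_nonneg hη M s))
    have hfactor : trunc η (M + 1) s * trunc η (M + 1) s - trunc η M s * trunc η M s =
        (rampWidth η M * ramp η M s) * (trunc η (M + 1) s + trunc η M s) := by rw [hdiff]; ring
    linarith

lemma sum_rampWidth_sq_mul_sub_le {T : ℕ → ℝ} (hT : ∀ k, 0 ≤ T k) (M : ℕ) :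
    ∑ k ∈ Finset.range M, rampWidth η k ^ 2 * (T k - T (k + 1)) ≤
      η ^ 2 * T 0 + 2 * η * ∑ k ∈ Finset.range M, rampWidth η k ^ 2 * T k := by
  set r : ℝ := 1 / (1 + η) ^ 2 with hr
  have hwidth : ∀ k, r * rampWidth η (k + 1) ^ 2 = rampWidth η k ^ 2 := by
    intro k; rw [hr, rampWidth, rampWidth]; field_simp; ring
  have hr0 : 0 ≤ r := by positivity
  have hr2η : 1 - r ≤ 2 * η := by
    rw [hr, sub_le_iff_le_add, ← sub_le_iff_le_add', le_div_iff₀ (by positivity)]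
    nlinarith [sq_nonneg η, mul_pos hη hη, pow_pos hη 3]
  have hr1 : r ≤ 1 := by
    rw [hr, div_le_one (by positivity)]; nlinarith
  have hparts : ∑ k ∈ Finset.range M, rampWidth η k ^ 2 * (T k - T (k + 1)) +
      r * rampWidth η M ^ 2 * T M ≤
      η ^ 2 * T 0 + (1 - r) * ∑ k ∈ Finset.range M, rampWidth η k ^ 2 * T k := by
    induction M with
    | zero =>
      have := mul_le_mul_of_nonneg_right hr1 (mul_nonneg (sq_nonneg η) (hT 0))
      simp only [Finset.range_zero, Finset.sum_empty, rampWidth, pow_zero]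
      linarith
    | succ M ih =>
      rw [Finset.sum_range_succ, Finset.sum_range_succ, hwidth]
      linarith
  have hlast : 0 ≤ r * rampWidth η M ^ 2 * T M := mul_nonneg (mul_nonneg hr0 (sq_nonneg _)) (hT M)
  have hsum : 0 ≤ ∑ k ∈ Finset.range M, rampWidth η k ^ 2 * T k :=
    Finset.sum_nonneg fun k _ => mul_nonneg (sq_nonneg _) (hT k)
  linarith [mul_le_mul_of_nonneg_right hr2η hsum]

/-- Averaging with the weights `rampWidth η k ^ 2`: the total decrease of `T` is a small fraction
of its total mass. -/
lemma exists_add_sub_succ_le {T D : ℕ → ℝ} (hT : ∀ k, 0 ≤ T k) (hT_succ : ∀ k, T (k + 1) ≤ T k)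
    (hD : ∀ k, 0 ≤ D k) {d : ℝ} {M : ℕ}
    (hlt : η ^ 2 * T 0 + ∑ k ∈ Finset.range M, rampWidth η k ^ 2 * D k <
      (d - 2 * η) * ∑ k ∈ Finset.range M, rampWidth η k ^ 2 * T k) :
    ∃ k, 0 < T k ∧ D k + (T k - T (k + 1)) ≤ d * T k := by
  by_contra! hcon
  have hle : ∀ k, d * T k ≤ D k + (T k - T (k + 1)) := fun k => by
    rcases (hT k).lt_or_eq with hk | hk
    · exact (hcon k hk).le
    · rw [← hk, mul_zero]
      linarith [hD k, hT_succ k]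
  have hsum : d * ∑ k ∈ Finset.range M, rampWidth η k ^ 2 * T k ≤
      ∑ k ∈ Finset.range M, rampWidth η k ^ 2 * D k +
        ∑ k ∈ Finset.range M, rampWidth η k ^ 2 * (T k - T (k + 1)) := by
    rw [Finset.mul_sum, ← Finset.sum_add_distrib]
    refine Finset.sum_le_sum fun k _ => ?_
    linarith [mul_le_mul_of_nonneg_left (hle k) (sq_nonneg (rampWidth η k))]
  linarith [sum_rampWidth_sq_mul_sub_le hη hT M]

end Ramp

section CfcTrace

variable {A : Type*} [CStarAlgebra A] [PartialOrder A] [StarOrderedRing A] (τ : A →ₚ[ℂ] ℂ)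

lemma l2Norm_cfc_sq {φ : ℝ → ℝ} (hφ : Continuous φ) (x : A) :
    l2Norm τ (cfc φ x) ^ 2 = (τ (cfc (fun s => φ s * φ s) x)).re := by
  rw [l2Norm_sq_of_isSelfAdjoint τ (cfc_predicate φ x),
    cfc_mul φ φ x hφ.continuousOn hφ.continuousOn]

lemma re_map_cfc_mono {φ ψ : ℝ → ℝ} (hφ : Continuous φ) (hψ : Continuous ψ) {x : A}
    (hle : ∀ s ∈ spectrum ℝ x, φ s ≤ ψ s) : (τ (cfc φ x)).re ≤ (τ (cfc ψ x)).re :=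
  re_map_mono τ (cfc_mono hle hφ.continuousOn hψ.continuousOn)

variable {η : ℝ} (hη : 0 < η) (k : ℕ) (x : A)
include hη

lemma re_map_cfc_ramp_nonneg : 0 ≤ (τ (cfc (ramp η k) x)).re :=
  re_map_nonneg τ (cfc_nonneg fun s _ => ramp_nonneg hη k s)

lemma re_map_cfc_ramp_le_l2Norm_trunc_sq :
    (τ (cfc (ramp η k) x)).re ≤ l2Norm τ (cfc (trunc η 0) x) ^ 2 := by
  rw [l2Norm_cfc_sq τ (continuous_trunc 0)]
  exact re_map_cfc_mono τ (continuous_ramp k) (by fun_prop) fun s _ => ramp_le_trunc_zero_sq hη k s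

lemma re_map_cfc_ramp_succ_le_l2Norm_sq :
    (τ (cfc (ramp η (k + 1)) x)).re ≤ l2Norm τ (cfc (ramp η k) x) ^ 2 := by
  rw [l2Norm_cfc_sq τ (continuous_ramp k)]
  exact re_map_cfc_mono τ (continuous_ramp _) (by fun_prop) fun s _ => ramp_succ_le_sq hη k s

lemma l2Norm_cfc_ramp_sq_le_re_map :
    l2Norm τ (cfc (ramp η k) x) ^ 2 ≤ (τ (cfc (ramp η k) x)).re := by
  rw [l2Norm_cfc_sq τ (continuous_ramp k)]
  exact re_map_cfc_mono τ (by fun_prop) (continuous_ramp _) fun s _ =>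
    mul_le_of_le_one_left (ramp_nonneg hη k s) (ramp_le_one hη k s)

omit k in
lemma l2Norm_sq_le_trunc_add_sum_ramp {x : A} (hx : IsSelfAdjoint x) {M : ℕ}
    (hM : ‖x‖ ≤ (1 + η) ^ M) :
    l2Norm τ x ^ 2 ≤ l2Norm τ (cfc (trunc η 0) x) ^ 2 + (2 + η) / η *
      ∑ k ∈ Finset.range M, rampWidth η k ^ 2 * (τ (cfc (ramp η k) x)).re := by
  set g : ℝ → ℝ := ∑ k ∈ Finset.range M, fun s => (2 + η) / η * rampWidth η k ^ 2 * ramp η k s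
    with hg
  have hgc : Continuous g := by
    rw [hg, Finset.sum_fn]
    fun_prop
  have hsum : cfc g x = ∑ k ∈ Finset.range M,
      ((2 + η) / η * rampWidth η k ^ 2) • cfc (ramp η k) x := by
    rw [hg, cfc_sum _ x _ (fun k _ => by fun_prop)]
    exact Finset.sum_congr rfl fun k _ => cfc_const_mul _ _ x (continuous_ramp k).continuousOn
  have hle : ∀ s ∈ spectrum ℝ x, s * s ≤ trunc η 0 s * trunc η 0 s + g s := fun s hs => by
    have hs' : |s| ≤ (1 + η) ^ M := (abs_le_norm_of_mem_spectrum hs).trans hM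
    have hM_sq := trunc_sq_le hη M s
    rw [trunc, min_eq_left hs', abs_mul_abs_self] at hM_sq
    simpa [hg, Finset.sum_apply] using hM_sq
  calc l2Norm τ x ^ 2 = (τ (cfc (fun s : ℝ => s * s) x)).re := by
        rw [← l2Norm_cfc_sq τ continuous_id' x, cfc_id' ℝ x]
    _ ≤ (τ (cfc (fun s => trunc η 0 s * trunc η 0 s + g s) x)).re :=
        re_map_cfc_mono τ (by fun_prop) (by fun_prop) hle
    _ = _ := by
        rw [cfc_add x (fun s => trunc η 0 s * trunc η 0 s) g (by fun_prop) hgc.continuousOn, hsum,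
          map_add, map_sum, Complex.add_re, Complex.re_sum, l2Norm_cfc_sq τ (continuous_trunc 0),
          Finset.mul_sum]
        simp only [re_map_smul, mul_assoc]

end CfcTrace

namespace IsTracialState

variable {A : Type*} [CStarAlgebra A] [PartialOrder A] [StarOrderedRing A] {τ : A →ₚ[ℂ] ℂ}

lemma sum_rampWidth_sq_mul_l2Norm_sq_le (h : IsTracialState τ) {η : ℝ} (hη : 0 < η) (M : ℕ)
    {x y : A} (hx : IsSelfAdjoint x) (hy : IsSelfAdjoint y) :
    ∑ k ∈ Finset.range M, rampWidth η k ^ 2 *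
      l2Norm τ (cfc (ramp η k) y - cfc (ramp η k) x) ^ 2 ≤ l2Norm τ (y - x) ^ 2 := by
  have hscale : ∀ k, l2Norm τ (cfc (fun s => rampWidth η k * ramp η k s) y -
      cfc (fun s => rampWidth η k * ramp η k s) x) ^ 2 =
      rampWidth η k ^ 2 * l2Norm τ (cfc (ramp η k) y - cfc (ramp η k) x) ^ 2 := fun k => by
    rw [cfc_const_mul _ _ x (continuous_ramp k).continuousOn,
      cfc_const_mul _ _ y (continuous_ramp k).continuousOn, ← smul_sub, ← Complex.coe_smul,
      l2Norm_smul, Complex.norm_real, Real.norm_eq_abs, mul_pow |_|, sq_abs]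
  simp only [← hscale]
  exact h.sum_l2Norm_cfc_sub_cfc_sq_le (Finset.range M)
    (fun k => continuous_const.mul (continuous_ramp k)) (sum_ramp_sub_sq_le hη M) hy hx

lemma exists_ramp (h : IsTracialState τ) {ι : Type*} [Fintype ι] {d ε : ℝ} (hd0 : 0 < d)
    (hd1 : d ≤ 1 / 2) (hε : (Fintype.card ι + 1) * ε ≤ d ^ 2 / 100) {x : A} {y : ι → A}
    (hx : IsSelfAdjoint x) (hy : ∀ i, IsSelfAdjoint (y i)) (hx1 : l2Norm τ x = 1)
    (hxε : l2Norm τ (cfc (trunc (d / 4) 0) x) ^ 2 ≤ ε) (hxy : ∀ i, l2Norm τ (y i - x) ^ 2 ≤ ε) :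
    ∃ k, 0 < (τ (cfc (ramp (d / 4) k) x)).re ∧
      ∑ i, l2Norm τ (cfc (ramp (d / 4) k) (y i) - cfc (ramp (d / 4) k) x) ^ 2 +
        ((τ (cfc (ramp (d / 4) k) x)).re - (τ (cfc (ramp (d / 4) (k + 1)) x)).re) ≤
      d * (τ (cfc (ramp (d / 4) k) x)).re := by
  have hη : 0 < d / 4 := by positivity
  have hT0 := re_map_cfc_ramp_le_l2Norm_trunc_sq τ hη 0 x
  obtain ⟨M, hM⟩ := pow_unbounded_of_one_lt ‖x‖ (by linarith : 1 < 1 + d / 4)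
  have hmass := l2Norm_sq_le_trunc_add_sum_ramp τ hη hx hM.le
  refine exists_add_sub_succ_le hη (T := fun k => (τ (cfc (ramp (d / 4) k) x)).re) (M := M)
    (fun k => re_map_cfc_ramp_nonneg τ hη k x)
    (fun k => (re_map_cfc_ramp_succ_le_l2Norm_sq τ hη k x).trans
      (l2Norm_cfc_ramp_sq_le_re_map τ hη k x))
    (fun k => Finset.sum_nonneg fun i _ => sq_nonneg _) ?_
  set W := ∑ k ∈ Finset.range M, rampWidth (d / 4) k ^ 2 * (τ (cfc (ramp (d / 4) k) x)).re
  have hincr : ∑ k ∈ Finset.range M, rampWidth (d / 4) k ^ 2 *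
      ∑ i, l2Norm τ (cfc (ramp (d / 4) k) (y i) - cfc (ramp (d / 4) k) x) ^ 2 ≤
      Fintype.card ι * ε := by
    simp only [Finset.mul_sum]
    rw [Finset.sum_comm, ← nsmul_eq_mul]
    exact Finset.sum_le_card_nsmul _ _ _ fun i _ =>
      (h.sum_rampWidth_sq_mul_l2Norm_sq_le hη M hx (hy i)).trans (hxy i)
  have hε0 : 0 ≤ ε := (sq_nonneg _).trans hxε
  have hεd : ε ≤ d ^ 2 / 100 := by nlinarith [(Nat.cast_nonneg (Fintype.card ι) : (0 : ℝ) ≤ _)]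
  have hW : d / 24 ≤ W := by
    have : 1 / 2 ≤ (2 + d / 4) / (d / 4) * W := by
      rw [hx1] at hmass
      nlinarith
    rw [div_mul_eq_mul_div, le_div_iff₀ hη] at this
    nlinarith
  have hηT : (d / 4) ^ 2 * (τ (cfc (ramp (d / 4) 0) x)).re ≤ ε :=
    (mul_le_of_le_one_left (re_map_cfc_ramp_nonneg τ hη 0 x)
      (pow_le_one₀ hη.le (by linarith))).trans (hT0.trans hxε)
  nlinarith [mul_le_mul_of_nonneg_left hW hd0.le]

/-- Namioka's trick: averaging over the heights `(1 + η) ^ k`, one of the ramp functions of `x`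
moves little relative to its own mass. -/
theorem exists_cutoff (h : IsTracialState τ) (ι : Type*) [Finite ι] {δ : ℝ} (hδ : 0 < δ) :
    ∃ ε > 0, ∀ (x : A) (y : ι → A),
      IsSelfAdjoint x → (∀ i, IsSelfAdjoint (y i)) → l2Norm τ x = 1 →
      l2Norm τ (cfc (fun s : ℝ => min |s| 1) x) ^ 2 ≤ ε →
      (∀ i, l2Norm τ (y i - x) ^ 2 ≤ ε) →
      ∃ φ : ℝ → ℝ, Continuous φ ∧ (∀ s, 0 ≤ φ s ∧ φ s ≤ 1) ∧ 0 < l2Norm τ (cfc φ x) ∧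
        (∀ i, l2Norm τ (cfc φ (y i) - cfc φ x) ^ 2 ≤ δ * l2Norm τ (cfc φ x) ^ 2) ∧
        (τ (cfc φ x)).re - l2Norm τ (cfc φ x) ^ 2 ≤ δ * l2Norm τ (cfc φ x) ^ 2 ∧
        l2Norm τ (cfc φ x) ^ 2 ≤ δ := by
  have := Fintype.ofFinite ι
  obtain ⟨d, hd0, hd1, hdδ⟩ : ∃ d > 0, d ≤ 1 / 2 ∧ 2 * d ≤ δ :=
    ⟨min δ 1 / 2, by positivity, by linarith [min_le_right δ 1], by linarith [min_le_left δ 1]⟩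
  have hη : 0 < d / 4 := by positivity
  have hε : (Fintype.card ι + 1) * (d ^ 2 / (100 * (Fintype.card ι + 1))) = d ^ 2 / 100 := by
    field_simp
  refine ⟨d ^ 2 / (100 * (Fintype.card ι + 1)), by positivity,
    fun x y hx hy hx1 hxε hxy => ?_⟩
  have hxε' : l2Norm τ (cfc (trunc (d / 4) 0) x) ^ 2 ≤ d ^ 2 / (100 * (Fintype.card ι + 1)) := by
    simpa only [funext (trunc_zero (η := d / 4))] using hxε
  obtain ⟨k, hTk, hk⟩ := h.exists_ramp hd0 hd1 hε.le hx hy hx1 hxε' hxy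
  have hQ := re_map_cfc_ramp_succ_le_l2Norm_sq τ hη k x
  have hQ' := l2Norm_cfc_ramp_sq_le_re_map τ hη k x
  have hTε := re_map_cfc_ramp_le_l2Norm_trunc_sq τ hη k x
  set Q := l2Norm τ (cfc (ramp (d / 4) k) x) ^ 2 with hQdef
  have hterm : ∀ i, l2Norm τ (cfc (ramp (d / 4) k) (y i) - cfc (ramp (d / 4) k) x) ^ 2 ≤
      ∑ i, l2Norm τ (cfc (ramp (d / 4) k) (y i) - cfc (ramp (d / 4) k) x) ^ 2 := fun i =>
    Finset.single_le_sum (f := fun i => l2Norm τ (cfc (ramp (d / 4) k) (y i) -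
      cfc (ramp (d / 4) k) x) ^ 2) (fun i _ => sq_nonneg _) (Finset.mem_univ i)
  have hsum : 0 ≤ ∑ i, l2Norm τ (cfc (ramp (d / 4) k) (y i) - cfc (ramp (d / 4) k) x) ^ 2 :=
    Finset.sum_nonneg fun i _ => sq_nonneg _
  have hTQ : (τ (cfc (ramp (d / 4) k) x)).re ≤ 2 * Q := by nlinarith
  refine ⟨ramp (d / 4) k, continuous_ramp k, fun s => ⟨ramp_nonneg hη k s, ramp_le_one hη k s⟩,
    ?_, fun i => ?_, ?_, ?_⟩
  · exact (l2Norm_nonneg τ _).lt_of_ne' fun h0 => by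
      rw [hQdef, h0] at hTQ
      linarith
  · nlinarith [hterm i]
  · nlinarith
  · have : (0 : ℝ) ≤ Fintype.card ι := Nat.cast_nonneg _
    nlinarith [sq_nonneg (l2Norm τ (cfc (trunc (d / 4) 0) x))]

end IsTracialState

/-! ### Extending an almost projection -/

lemma isSelfAdjoint_mul_self {R : Type*} [Mul R] [StarMul R] {x : R} (hx : IsSelfAdjoint x) :
    IsSelfAdjoint (x * x) := by
  rw [isSelfAdjoint_iff, star_mul, hx.star_eq]

lemma isSelfAdjoint_mul_mul_self_mul {R : Type*} [Semigroup R] [StarMul R] {r y : R}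
    (hr : IsSelfAdjoint r) (hy : IsSelfAdjoint y) : IsSelfAdjoint (r * (y * y) * r) := by
  simpa only [hr.star_eq] using (isSelfAdjoint_mul_self hy).conjugate r

lemma mul_mul_self_mul_sub_eq {R : Type*} [Ring R] (s y Y : R) :
    s * (Y * Y) * s - s * s * (y * y) =
      s * (Y - y) * (Y * s) + s * y * ((Y - y) * s) + s * y * (y * s - s * y)
        + s * (y * s - s * y) * y := by
  noncomm_ring

section UnitInterval

variable {A : Type*} [CStarAlgebra A] [PartialOrder A] [StarOrderedRing A]

lemma mul_self_le_self_of_le_one {a : A} (h0 : 0 ≤ a) (h1 : a ≤ 1) : a * a ≤ a := by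
  have : 0 ≤ a * (1 - a) := Commute.mul_nonneg h0 (sub_nonneg.mpr h1)
    ((Commute.one_right a).sub_right (Commute.refl a))
  rwa [mul_sub, mul_one, sub_nonneg] at this

lemma norm_le_one_of_nonneg_of_le_one {a : A} (h0 : 0 ≤ a) (h1 : a ≤ 1) : ‖a‖ ≤ 1 :=
  (CStarAlgebra.norm_le_one_iff_of_nonneg a h0).mpr h1

lemma norm_le_one_of_mul_self_eq_one_sub {r q : A} (hr : IsSelfAdjoint r) (hrq : r * r = 1 - q)
    (h0 : 0 ≤ q) (h1 : q ≤ 1) : ‖r‖ ≤ 1 := by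
  have hsq : ‖r‖ * ‖r‖ ≤ 1 := by
    rw [← CStarRing.norm_star_mul_self, hr.star_eq, hrq]
    exact norm_le_one_of_nonneg_of_le_one (sub_nonneg.mpr h1) (sub_le_self 1 h0)
  nlinarith [norm_nonneg r]

end UnitInterval

namespace IsTracialState

variable {A : Type*} [CStarAlgebra A] [PartialOrder A] [StarOrderedRing A] {τ : A →ₚ[ℂ] ℂ}

lemma abs_re_mul_mul_le (h : IsTracialState τ) (z : A) {b c : A} {β γ : ℝ}
    (hb : l2Norm τ b ≤ β) (hc : l2Norm τ c ≤ γ) :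
    |(τ (z * (b * c))).re| ≤ ‖z‖ * (β * γ) := by
  rw [← mul_assoc, mul_assoc, ← mul_assoc]
  calc |(τ (z * b * c)).re| ≤ l2Norm τ (z * b) * l2Norm τ c := h.abs_re_mul_le _ _
    _ ≤ (‖z‖ * l2Norm τ b) * l2Norm τ c :=
        mul_le_mul_of_nonneg_right (l2Norm_mul_le τ z b) (l2Norm_nonneg τ c)
    _ = ‖z‖ * (l2Norm τ b * l2Norm τ c) := mul_assoc _ _ _
    _ ≤ ‖z‖ * (β * γ) := mul_le_mul_of_nonneg_left
        (mul_le_mul hb hc (l2Norm_nonneg τ c) ((l2Norm_nonneg τ b).trans hb)) (norm_nonneg z)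

lemma l2Norm_add_sq (h : IsTracialState τ) {x y : A} (hx : IsSelfAdjoint x)
    (hy : IsSelfAdjoint y) :
    l2Norm τ (x + y) ^ 2 = l2Norm τ x ^ 2 + 2 * (τ (x * y)).re + l2Norm τ y ^ 2 := by
  rw [l2Norm_sq_of_isSelfAdjoint τ (hx.add hy), l2Norm_sq_of_isSelfAdjoint τ hx,
    l2Norm_sq_of_isSelfAdjoint τ hy]
  simp only [add_mul, mul_add, map_add, h.map_mul_comm y x, Complex.add_re]
  ring

section Conjugation

variable {s y Y : A} {ε : ℝ}

lemma l2Norm_mul_mul_self_mul_sub_le (h : IsTracialState τ) (hs : ‖s‖ ≤ 1) (hy : ‖y‖ ≤ 1)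
    (hY : ‖Y‖ ≤ 1) (hYy : l2Norm τ (Y - y) ≤ ε) (hsy : l2Norm τ (s * y - y * s) ≤ ε) :
    l2Norm τ (s * (Y * Y) * s - s * s * (y * y)) ≤ 4 * ε := by
  have hYs : ‖Y * s‖ ≤ 1 := (norm_mul_le _ _).trans (mul_le_one₀ hY (norm_nonneg _) hs)
  have hsy1 : ‖s * y‖ ≤ 1 := (norm_mul_le _ _).trans (mul_le_one₀ hs (norm_nonneg _) hy)
  rw [l2Norm_sub_comm] at hsy
  have h₁ : l2Norm τ (s * (Y - y) * (Y * s)) ≤ ε :=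
    (h.l2Norm_mul_le_of_norm_le_one_right hYs _).trans <|
      (l2Norm_mul_le_of_norm_le_one τ hs _).trans hYy
  have h₂ : l2Norm τ (s * y * ((Y - y) * s)) ≤ ε :=
    (l2Norm_mul_le_of_norm_le_one τ hsy1 _).trans <|
      (h.l2Norm_mul_le_of_norm_le_one_right hs _).trans hYy
  have h₃ : l2Norm τ (s * y * (y * s - s * y)) ≤ ε :=
    (l2Norm_mul_le_of_norm_le_one τ hsy1 _).trans hsy
  have h₄ : l2Norm τ (s * (y * s - s * y) * y) ≤ ε :=
    (h.l2Norm_mul_le_of_norm_le_one_right hy _).trans <|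
      (l2Norm_mul_le_of_norm_le_one τ hs _).trans hsy
  rw [mul_mul_self_mul_sub_eq]
  linarith [l2Norm_add_le τ (s * (Y - y) * (Y * s) + s * y * ((Y - y) * s) +
      s * y * (y * s - s * y)) (s * (y * s - s * y) * y),
    l2Norm_add_le τ (s * (Y - y) * (Y * s) + s * y * ((Y - y) * s)) (s * y * (y * s - s * y)),
    l2Norm_add_le τ (s * (Y - y) * (Y * s)) (s * y * ((Y - y) * s))]

lemma abs_re_mul_mul_mul_self_mul_sub_le (h : IsTracialState τ) (hs : ‖s‖ ≤ 1)
    (hYy : l2Norm τ (Y - y) ≤ ε) (hsy : l2Norm τ (s * y - y * s) ≤ ε) (hε : ε ≤ l2Norm τ y)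
    (z : A) :
    |(τ (z * (s * (Y * Y) * s - s * s * (y * y)))).re| ≤ ‖z‖ * (5 * ε * l2Norm τ y) := by
  have hY2 : l2Norm τ Y ≤ 2 * l2Norm τ y := by
    have := l2Norm_add_le τ (Y - y) y
    rw [sub_add_cancel] at this
    linarith
  rw [l2Norm_sub_comm] at hsy
  have hsub : l2Norm τ (s * (Y - y)) ≤ ε := (l2Norm_mul_le_of_norm_le_one τ hs _).trans hYy
  have hcomm : l2Norm τ (s * (y * s - s * y)) ≤ ε :=
    (l2Norm_mul_le_of_norm_le_one τ hs _).trans hsy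
  have hsy2 : l2Norm τ (s * y) ≤ l2Norm τ y := l2Norm_mul_le_of_norm_le_one τ hs _
  have h₁ := abs_le.mp <| h.abs_re_mul_mul_le z hsub
    ((h.l2Norm_mul_le_of_norm_le_one_right hs _).trans hY2)
  have h₂ := abs_le.mp <| h.abs_re_mul_mul_le z hsy2
    ((h.l2Norm_mul_le_of_norm_le_one_right hs _).trans hYy)
  have h₃ := abs_le.mp <| h.abs_re_mul_mul_le z hsy2 hsy
  have h₄ := abs_le.mp <| h.abs_re_mul_mul_le z hcomm (le_refl (l2Norm τ y))
  rw [mul_mul_self_mul_sub_eq]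
  simp only [mul_add z, map_add, Complex.add_re]
  exact abs_le.mpr ⟨by linarith, by linarith⟩

end Conjugation

section Extension

variable {q r y : A} {ε : ℝ}

omit [StarOrderedRing A] in
lemma re_map_mul_mul_self_mul (h : IsTracialState τ) (r y : A) :
    (τ (r * (y * y) * r)).re = (τ (r * r * (y * y))).re := by
  rw [h.map_mul_comm, mul_assoc]

omit [StarOrderedRing A] in
lemma re_map_mul_mul_mul_self_mul (h : IsTracialState τ) (hrq : r * r = 1 - q) :
    (τ (q * (r * (y * y) * r))).re
      = (τ (r * r * (y * y))).re - (τ (r * r * (r * r) * (y * y))).re := by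
  have hq : q = 1 - r * r := by rw [hrq, sub_sub_cancel]
  have e : r * (q * r * (y * y)) = r * r * (y * y) - r * r * (r * r) * (y * y) := by
    rw [hq]; noncomm_ring
  rw [← Complex.sub_re, ← map_sub, ← e, h.map_mul_comm r]
  simp only [mul_assoc]

lemma re_map_add_mul_mul_self_mul (h : IsTracialState τ) (hr : IsSelfAdjoint r)
    (hy : IsSelfAdjoint y) (q : A) :
    (τ (q + r * (y * y) * r)).re = (τ q).re + l2Norm τ (r * y) ^ 2 := by
  rw [l2Norm_sq, star_mul, hr.star_eq, hy.star_eq, map_add, Complex.add_re, mul_assoc y,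
    h.map_mul_comm y, h.map_mul_comm _ r]
  simp only [mul_assoc]

lemma re_mul_self_mul_sub_l2Norm_sq_le (h : IsTracialState τ) {a : A} (ha0 : 0 ≤ a) (ha1 : a ≤ 1)
    (hy0 : 0 ≤ y) (hy1 : y ≤ 1) :
    (τ (a * a * (y * y))).re - l2Norm τ (a * (y * y)) ^ 2
      ≤ l2Norm τ y ^ 2 - l2Norm τ (y * y) ^ 2 := by
  have hy : IsSelfAdjoint y := .of_nonneg hy0
  have hyy : IsSelfAdjoint (y * y) := isSelfAdjoint_mul_self hy
  have hyy0 : 0 ≤ y * y := hy.mul_self_nonneg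
  have hyy1 : y * y ≤ 1 := (mul_self_le_self_of_le_one hy0 hy1).trans hy1
  have haa1 : a * a ≤ 1 := (mul_self_le_self_of_le_one ha0 ha1).trans ha1
  have hsq : l2Norm τ (a * (y * y)) ^ 2 = (τ (a * a * (y * y * (y * y)))).re := by
    rw [l2Norm_sq, star_mul, (IsSelfAdjoint.of_nonneg ha0).star_eq, hyy.star_eq,
      mul_assoc (y * y), h.map_mul_comm (y * y)]
    simp only [mul_assoc]
  have := h.re_mul_nonneg (sub_nonneg.mpr haa1)
    (sub_nonneg.mpr (mul_self_le_self_of_le_one hyy0 hyy1))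
  rw [hsq, l2Norm_sq_of_isSelfAdjoint τ hy, l2Norm_sq_of_isSelfAdjoint τ hyy]
  simp only [sub_mul, mul_sub, one_mul, map_sub, Complex.sub_re] at this
  linarith

lemma l2Norm_mul_self_mul_sq_sub_le (h : IsTracialState τ) (hr : ‖r‖ ≤ 1) (hy : ‖y‖ ≤ 1)
    (hry : l2Norm τ (r * y - y * r) ≤ ε) :
    l2Norm τ (r * r * (y * y)) ^ 2 - 8 * ε * l2Norm τ y ≤ l2Norm τ (r * (y * y) * r) ^ 2 := by
  have hε : 0 ≤ ε := (l2Norm_nonneg τ _).trans hry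
  have hdiff := h.l2Norm_mul_mul_self_mul_sub_le hr hy hy
    (by rwa [sub_self, l2Norm_zero]) hry
  have htri := l2Norm_sub_le τ (r * (y * y) * r) (r * (y * y) * r - r * r * (y * y))
  rw [sub_sub_cancel] at htri
  have hle : l2Norm τ (r * r * (y * y)) ≤ l2Norm τ y :=
    (l2Norm_mul_le_of_norm_le_one τ
      ((norm_mul_le _ _).trans (mul_le_one₀ hr (norm_nonneg _) hr)) _).trans
      (l2Norm_mul_le_of_norm_le_one τ hy _)
  have h0 := l2Norm_nonneg τ (r * r * (y * y))
  have h0' := l2Norm_nonneg τ (r * (y * y) * r)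
  have := mul_le_mul_of_nonneg_left hle hε
  rcases le_total (l2Norm τ (r * r * (y * y))) (l2Norm τ (r * (y * y) * r)) with hcase | hcase
  · nlinarith
  · have hfactor := mul_le_mul_of_nonneg_right
      (show l2Norm τ (r * r * (y * y)) - l2Norm τ (r * (y * y) * r) ≤ 4 * ε by linarith)
      (add_nonneg h0 h0')
    nlinarith

/-- The defect of `q + √(1 - q) y² √(1 - q)` from being a projection exceeds that of `q` by little
more than the defect of `y`. -/
lemma extension_defect_le (h : IsTracialState τ) (hq0 : 0 ≤ q) (hq1 : q ≤ 1)
    (hr : IsSelfAdjoint r) (hrq : r * r = 1 - q) (hy0 : 0 ≤ y) (hy1 : y ≤ 1)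
    (hry : l2Norm τ (r * y - y * r) ≤ ε)
    (hproj : l2Norm τ y ^ 2 - l2Norm τ (y * y) ^ 2 ≤ ε * l2Norm τ y) :
    (τ (q + r * (y * y) * r)).re - l2Norm τ (q + r * (y * y) * r) ^ 2 ≤
      (τ q).re - l2Norm τ q ^ 2 + 9 * ε * l2Norm τ y := by
  have hy : IsSelfAdjoint y := .of_nonneg hy0
  have hrr0 : 0 ≤ r * r := hr.mul_self_nonneg
  have hrr1 : r * r ≤ 1 := hrq.trans_le (sub_le_self 1 hq0)
  have hcomm := h.l2Norm_mul_self_mul_sq_sub_le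
    (norm_le_one_of_mul_self_eq_one_sub hr hrq hq0 hq1) (norm_le_one_of_nonneg_of_le_one hy0 hy1)
    hry
  have hdefect := h.re_mul_self_mul_sub_l2Norm_sq_le hrr0 hrr1 hy0 hy1
  have hcross : 0 ≤ (τ (r * r * (y * y))).re - (τ (r * r * (r * r) * (y * y))).re := by
    have := h.re_mul_nonneg (sub_nonneg.mpr (mul_self_le_self_of_le_one hrr0 hrr1))
      hy.mul_self_nonneg
    simpa only [sub_mul, map_sub, Complex.sub_re] using this
  rw [h.l2Norm_add_sq (.of_nonneg hq0) (isSelfAdjoint_mul_mul_self_mul hr hy), map_add,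
    Complex.add_re, h.re_map_mul_mul_self_mul, h.re_map_mul_mul_mul_self_mul hrq]
  linarith

lemma l2Norm_add_sub_mul_mul_self_sq_le (h : IsTracialState τ) {z d : A} (hz : IsSelfAdjoint z)
    (hy : IsSelfAdjoint y) (hd : IsSelfAdjoint (d - z * (y * y))) (hzn : ‖z‖ ≤ 2) (hyn : ‖y‖ ≤ 1)
    (hε : ε ≤ l2Norm τ y) (hdε : l2Norm τ d ≤ 8 * ε)
    (hzd : (τ (z * d)).re ≤ 20 * ε * l2Norm τ y) :
    l2Norm τ (z + (d - z * (y * y))) ^ 2 ≤ l2Norm τ z ^ 2 + 150 * ε * l2Norm τ y := by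
  have hε0 : 0 ≤ ε := by linarith [l2Norm_nonneg τ d]
  have hsq : (τ (z * (z * (y * y)))).re = l2Norm τ (z * y) ^ 2 := by
    rw [l2Norm_sq, star_mul, hz.star_eq, hy.star_eq, mul_assoc y, h.map_mul_comm y]
    simp only [mul_assoc]
  have hnorm : l2Norm τ (d - z * (y * y)) ≤ l2Norm τ (z * y) + 8 * ε := by
    have : l2Norm τ (z * (y * y)) ≤ l2Norm τ (z * y) := by
      rw [← mul_assoc]; exact h.l2Norm_mul_le_of_norm_le_one_right hyn _
    linarith [l2Norm_sub_le τ d (z * (y * y))]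
  have hzy : l2Norm τ (z * y) ≤ 2 * l2Norm τ y :=
    (l2Norm_mul_le τ z y).trans (mul_le_mul_of_nonneg_right hzn (l2Norm_nonneg τ y))
  have hnorm_sq := pow_le_pow_left₀ (l2Norm_nonneg τ _) hnorm 2
  rw [h.l2Norm_add_sq hz hd, mul_sub, map_sub, Complex.sub_re, hsq]
  nlinarith [mul_le_mul_of_nonneg_left hzy hε0, mul_le_mul_of_nonneg_left hε hε0,
    sq_nonneg (l2Norm τ (z * y))]

/-- The displacement of `q + √(1 - q) y² √(1 - q)` under `θ` exceeds that of `q` by little: up to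
a small error the displacement of the second summand is `-z y²`, where `z = θ q - q`. -/
lemma extension_displacement_le (h : IsTracialState τ) (θ : A ≃⋆ₐ[ℂ] A) (hε : ε ≤ l2Norm τ y)
    (hq0 : 0 ≤ q) (hq1 : q ≤ 1) (hr : IsSelfAdjoint r) (hrq : r * r = 1 - q) (hy0 : 0 ≤ y)
    (hy1 : y ≤ 1) (hry : l2Norm τ (r * y - y * r) ≤ ε)
    (hθry : l2Norm τ (θ r * y - y * θ r) ≤ ε) (hθy : l2Norm τ (θ y - y) ≤ ε) :
    l2Norm τ (θ (q + r * (y * y) * r) - (q + r * (y * y) * r)) ^ 2 ≤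
      l2Norm τ (θ q - q) ^ 2 + 150 * ε * l2Norm τ y := by
  have hε0 : 0 ≤ ε := (l2Norm_nonneg τ _).trans hry
  have hy : IsSelfAdjoint y := .of_nonneg hy0
  have hyn := norm_le_one_of_nonneg_of_le_one hy0 hy1
  have hrn := norm_le_one_of_mul_self_eq_one_sub hr hrq hq0 hq1
  have hθn (x : A) : ‖θ x‖ ≤ ‖x‖ := NonUnitalStarAlgHom.norm_apply_le θ x
  have hyy0 : l2Norm τ (y - y) ≤ ε := by rwa [sub_self, l2Norm_zero]
  set z := θ q - q with hz
  set d := (θ r * (θ y * θ y) * θ r - θ r * θ r * (y * y)) -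
    (r * (y * y) * r - r * r * (y * y)) with hd
  have hzs : IsSelfAdjoint z := ((IsSelfAdjoint.of_nonneg hq0).map θ).sub (.of_nonneg hq0)
  have hzn : ‖z‖ ≤ 2 := (norm_sub_le _ _).trans
    (by linarith [hθn q, norm_le_one_of_nonneg_of_le_one hq0 hq1])
  have hdisp : θ (r * (y * y) * r) - r * (y * y) * r = d - z * (y * y) := by
    have hθrr : θ r * θ r = 1 - θ q := by rw [← map_mul, hrq, map_sub, map_one]
    simp only [hd, hθrr, hrq, hz, map_mul]
    noncomm_ring
  have hsplit : θ (q + r * (y * y) * r) - (q + r * (y * y) * r) = z + (d - z * (y * y)) := by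
    rw [← hdisp, map_add, hz]; abel
  have hds : IsSelfAdjoint (d - z * (y * y)) := hdisp ▸
    ((isSelfAdjoint_mul_mul_self_mul hr hy).map θ).sub (isSelfAdjoint_mul_mul_self_mul hr hy)
  rw [hsplit]
  refine h.l2Norm_add_sub_mul_mul_self_sq_le hzs hy hds hzn hyn hε ?_ ?_
  · linarith [l2Norm_sub_le τ (θ r * (θ y * θ y) * θ r - θ r * θ r * (y * y))
        (r * (y * y) * r - r * r * (y * y)),
      h.l2Norm_mul_mul_self_mul_sub_le hrn hyn hyn hyy0 hry,
      h.l2Norm_mul_mul_self_mul_sub_le ((hθn r).trans hrn) hyn ((hθn y).trans hyn) hθy hθry]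
  · have hbound : ‖z‖ * (5 * ε * l2Norm τ y) ≤ 2 * (5 * ε * l2Norm τ y) :=
      mul_le_mul_of_nonneg_right hzn (by have := l2Norm_nonneg τ y; positivity)
    have h₁ := abs_le.mp <| h.abs_re_mul_mul_mul_self_mul_sub_le hrn hyy0 hry hε z
    have h₂ := abs_le.mp <|
      h.abs_re_mul_mul_mul_self_mul_sub_le ((hθn r).trans hrn) hθy hθry hε z
    rw [hd, mul_sub, map_sub, Complex.sub_re]
    linarith

end Extension

end IsTracialState

/-! ### Patching almost projections -/

/-- Continuous approximations of the indicator function of `(1 / 4, ∞)`, increasing in `m`. -/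
noncomputable def quarterStep (m : ℕ) (s : ℝ) : ℝ := min (m * max (s - 1 / 4) 0) 1

section QuarterStep

lemma continuous_quarterStep (m : ℕ) : Continuous (quarterStep m) := by
  unfold quarterStep; fun_prop

lemma quarterStep_nonneg (m : ℕ) (s : ℝ) : 0 ≤ quarterStep m s :=
  le_min (mul_nonneg (Nat.cast_nonneg m) (le_max_right _ _)) zero_le_one

lemma quarterStep_le_one (m : ℕ) (s : ℝ) : quarterStep m s ≤ 1 := min_le_right _ _

lemma quarterStep_mono {m k : ℕ} (h : m ≤ k) (s : ℝ) : quarterStep m s ≤ quarterStep k s :=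
  min_le_min (mul_le_mul_of_nonneg_right (by exact_mod_cast h) (le_max_right _ _)) le_rfl

lemma quarterStep_le_mul_self_add (m : ℕ) {k : ℕ} (hk : 0 < k) (s : ℝ) :
    quarterStep m s ≤ quarterStep k s * quarterStep k s + m / k := by
  have hk' : (0 : ℝ) < k := by exact_mod_cast hk
  have hm : (0 : ℝ) ≤ m := Nat.cast_nonneg m
  unfold quarterStep
  set d := max (s - 1 / 4) 0
  rcases le_total 1 (k * d) with h | h
  · rw [min_eq_right h]
    linarith [min_le_right (m * d) 1, div_nonneg hm hk'.le]
  · have hd : m * d ≤ m / k := by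
      rw [le_div_iff₀ hk']; nlinarith
    linarith [min_le_left (m * d) 1, mul_self_nonneg (min (k * d) 1)]

lemma quarterStep_le_four_mul (m : ℕ) {s : ℝ} (hs : 0 ≤ s) : quarterStep m s ≤ 4 * s := by
  unfold quarterStep
  rcases le_total (s - 1 / 4) 0 with h | h
  · rw [max_eq_right h, mul_zero]
    exact (min_le_left _ _).trans (by linarith)
  · exact (min_le_right _ _).trans (by linarith)

lemma le_quarterStep_one_add {s : ℝ} (hs : s ≤ 1) : s ≤ quarterStep 1 s + 1 / 4 := by
  unfold quarterStep
  rw [Nat.cast_one, one_mul, min_eq_left (max_le (by linarith) zero_le_one)]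
  linarith [le_max_left (s - 1 / 4) 0]

end QuarterStep

/-- The properties of the trace of a `II₁` factor which the patching argument uses: the algebra is
monotone complete, the trace is faithful and normal, and the complement of every projection of
trace at least `1 / 2` is equivalent to a subprojection. -/
structure IsFactorTrace {A : Type*} [CStarAlgebra A] [PartialOrder A] (τ : A →ₚ[ℂ] ℂ) : Prop
    extends IsTracialState τ where
  eq_zero_of_re_eq_zero : ∀ a : A, 0 ≤ a → (τ a).re = 0 → a = 0
  exists_isLUB : ∀ D : Set A, D.Nonempty → DirectedOn (· ≤ ·) D → (∀ d ∈ D, 0 ≤ d ∧ d ≤ 1) →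
    ∃ a, IsLUB D a
  isLUB_re_map : ∀ (D : Set A) (a : A), D.Nonempty → DirectedOn (· ≤ ·) D → (∀ d ∈ D, 0 ≤ d) →
    IsLUB D a → IsLUB ((fun d => (τ d).re) '' D) (τ a).re
  exists_star_mul_mul_eq_one_sub : ∀ e : A, IsStarProjection e → 1 / 2 ≤ (τ e).re →
    ∃ v : A, ‖v‖ ≤ 1 ∧ star v * e * v = 1 - e

section Order

variable {A : Type*} [CStarAlgebra A] [PartialOrder A] [StarOrderedRing A] {τ : A →ₚ[ℂ] ℂ}

lemma IsTracialState.re_map_mul_self_mono (h : IsTracialState τ) {x y : A} (hx : 0 ≤ x)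
    (hxy : x ≤ y) : (τ (x * x)).re ≤ (τ (y * y)).re :=
  calc (τ (x * x)).re ≤ (τ (x * y)).re := h.re_mul_mono hx hxy
    _ = (τ (y * x)).re := by rw [h.map_mul_comm]
    _ ≤ (τ (y * y)).re := h.re_mul_mono (hx.trans hxy) hxy

omit [StarOrderedRing A] in
lemma IsTracialState.re_map_add_algebraMap (h : IsTracialState τ) (x : A) (r : ℝ) :
    (τ (x + algebraMap ℝ A r)).re = (τ x).re + r := by
  rw [Algebra.algebraMap_eq_smul_one, map_add, Complex.add_re, re_map_smul, h.map_one,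
    Complex.one_re, mul_one]

lemma IsTracialState.l2Norm_le_of_re_le_sq (h : IsTracialState τ) {x : A} (h0 : 0 ≤ x)
    (h1 : x ≤ 1) {κ : ℝ} (hκ : 0 ≤ κ) (hx : (τ x).re ≤ κ ^ 2) : l2Norm τ x ≤ κ :=
  (pow_le_pow_iff_left₀ (l2Norm_nonneg τ x) hκ two_ne_zero).mp ((h.l2Norm_sq_le_re h0 h1).trans hx)

lemma starAlgEquiv_nonneg (θ : A ≃⋆ₐ[ℂ] A) {x : A} (hx : 0 ≤ x) : 0 ≤ θ x := by
  simpa using OrderHomClass.mono θ hx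

lemma starAlgEquiv_le_one (θ : A ≃⋆ₐ[ℂ] A) {x : A} (hx : x ≤ 1) : θ x ≤ 1 := by
  simpa using OrderHomClass.mono θ hx

variable {a : A}

lemma cfc_quarterStep_mono (a : A) : Monotone fun m => cfc (quarterStep m) a :=
  fun m k hmk => cfc_mono (fun s _ => quarterStep_mono hmk s)
    (continuous_quarterStep m).continuousOn (continuous_quarterStep k).continuousOn

lemma cfc_quarterStep_nonneg (m : ℕ) (a : A) : 0 ≤ cfc (quarterStep m) a :=
  cfc_nonneg fun s _ => quarterStep_nonneg m s

lemma cfc_quarterStep_le_mul_self_add (ha : IsSelfAdjoint a) (m : ℕ) {k : ℕ} (hk : 0 < k) :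
    cfc (quarterStep m) a ≤ cfc (quarterStep k) a * cfc (quarterStep k) a
      + algebraMap ℝ A (m / k) := by
  have hc (j : ℕ) := continuous_quarterStep j
  rw [← cfc_mul _ _ a (hc k).continuousOn (hc k).continuousOn, ← cfc_add_const _
    (fun s => quarterStep k s * quarterStep k s) a ((hc k).mul (hc k)).continuousOn]
  exact cfc_mono (fun s _ => quarterStep_le_mul_self_add m hk s) (hc m).continuousOn
    (((hc k).mul (hc k)).add continuous_const).continuousOn

lemma le_cfc_quarterStep_one_add (h0 : 0 ≤ a) (h1 : a ≤ 1) :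
    a ≤ cfc (quarterStep 1) a + algebraMap ℝ A (1 / 4) := by
  have ha : IsSelfAdjoint a := .of_nonneg h0
  have hc := continuous_quarterStep 1
  rw [← cfc_add_const _ _ a hc.continuousOn]
  conv_lhs => rw [← cfc_id' ℝ a]
  exact cfc_mono (fun s hs => le_quarterStep_one_add <| (le_abs_self s).trans <|
      (abs_le_norm_of_mem_spectrum hs).trans (norm_le_one_of_nonneg_of_le_one h0 h1))
    (by fun_prop) (hc.add continuous_const).continuousOn

/-- If `1 ≤ 4 (a + v* a v)` and `y` almost commutes with `v`, then a fixed proportion of the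
2-norm of `y` is seen by `a = r²`. -/
lemma IsTracialState.l2Norm_le_of_almost_commute (h : IsTracialState τ) {r v y : A}
    (hr : IsSelfAdjoint r) (hrn : ‖r‖ ≤ 1) (hv : ‖v‖ ≤ 1)
    (hrv : 1 ≤ (4 : ℝ) • (r * r + star v * (r * r) * v))
    (hvy : l2Norm τ (v * y - y * v) ≤ 1 / 8 * l2Norm τ y) :
    l2Norm τ y ≤ 8 * l2Norm τ (r * y) := by
  have hsq : l2Norm τ y ^ 2 ≤ 4 * (l2Norm τ (r * y) ^ 2 + l2Norm τ (r * (v * y)) ^ 2) := by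
    have hmono := re_map_mono τ (star_left_conjugate_le_conjugate hrv y)
    rw [mul_one, ← l2Norm_sq] at hmono
    refine hmono.trans_eq ?_
    rw [mul_smul_comm, smul_mul_assoc, re_map_smul, l2Norm_sq, l2Norm_sq, ← Complex.add_re,
      ← map_add]
    simp only [star_mul, hr.star_eq]
    congr 3
    noncomm_ring
  have hrvy : l2Norm τ (r * (v * y)) ≤ l2Norm τ (r * y) + 1 / 8 * l2Norm τ y := by
    have e : r * (v * y) = r * y * v + r * (v * y - y * v) := by noncomm_ring
    rw [e]
    exact (l2Norm_add_le τ _ _).trans <| add_le_add (h.l2Norm_mul_le_of_norm_le_one_right hv _)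
      ((l2Norm_mul_le_of_norm_le_one τ hrn _).trans hvy)
  by_contra! hc
  nlinarith [l2Norm_nonneg τ (r * y), l2Norm_nonneg τ (r * (v * y)), l2Norm_nonneg τ y]

end Order

namespace IsFactorTrace

variable {A : Type*} [CStarAlgebra A] [PartialOrder A] [StarOrderedRing A] {τ : A →ₚ[ℂ] ℂ}

section SpectralProjection

variable {a e : A}

lemma isStarProjection_of_isLUB_cfc_quarterStep (h : IsFactorTrace τ) (ha : IsSelfAdjoint a)
    (he : IsLUB (Set.range fun m => cfc (quarterStep m) a) e) : IsStarProjection e := by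
  have hle (m : ℕ) : cfc (quarterStep m) a ≤ e := he.1 ⟨m, rfl⟩
  have he0 : 0 ≤ e := (cfc_quarterStep_nonneg 0 a).trans (hle 0)
  have he1 : e ≤ 1 := he.2 <| by
    rintro _ ⟨m, rfl⟩
    exact cfc_le_one _ _ fun s _ => quarterStep_le_one m s
  have hlub := h.isLUB_re_map _ e (Set.range_nonempty _)
    (directedOn_range.mpr (cfc_quarterStep_mono a).directed_le)
    (by rintro _ ⟨m, rfl⟩; exact cfc_quarterStep_nonneg m a) he
  have hτ : (τ e).re ≤ (τ (e * e)).re := by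
    refine hlub.2 ?_
    rintro _ ⟨_, ⟨m, rfl⟩, rfl⟩
    have hlim : Tendsto (fun k : ℕ => (τ (e * e)).re + m / k) atTop (𝓝 (τ (e * e)).re) := by
      simpa using tendsto_const_nhds.add (tendsto_const_div_atTop_nhds_zero_nat (m : ℝ))
    refine ge_of_tendsto hlim (eventually_atTop.mpr ⟨1, fun k hk => ?_⟩)
    calc (τ (cfc (quarterStep m) a)).re
        ≤ (τ (cfc (quarterStep k) a * cfc (quarterStep k) a)).re + m / k :=
          (re_map_mono τ (cfc_quarterStep_le_mul_self_add ha m hk)).trans_eq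
            (h.re_map_add_algebraMap _ _)
      _ ≤ (τ (e * e)).re + m / k :=
          add_le_add_left (h.re_map_mul_self_mono (cfc_quarterStep_nonneg k a) (hle k)) _
  have hzero : e - e * e = 0 := by
    have hnonneg : 0 ≤ e - e * e := sub_nonneg.mpr (mul_self_le_self_of_le_one he0 he1)
    refine h.eq_zero_of_re_eq_zero _ hnonneg (le_antisymm ?_ (re_map_nonneg τ hnonneg))
    rw [map_sub, Complex.sub_re]
    linarith
  exact ⟨(sub_eq_zero.mp hzero).symm, .of_nonneg he0⟩

/-- The projection is the spectral projection of `a` for `(1 / 4, ∞)`. -/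
lemma exists_isStarProjection_le_four_smul (h : IsFactorTrace τ) (h0 : 0 ≤ a) (h1 : a ≤ 1) :
    ∃ e : A, IsStarProjection e ∧ e ≤ (4 : ℝ) • a ∧ (τ a).re - 1 / 4 ≤ (τ e).re := by
  have ha : IsSelfAdjoint a := .of_nonneg h0
  obtain ⟨e, he⟩ := h.exists_isLUB (Set.range fun m => cfc (quarterStep m) a)
    (Set.range_nonempty _) (directedOn_range.mpr (cfc_quarterStep_mono a).directed_le) <| by
      rintro _ ⟨m, rfl⟩
      exact ⟨cfc_quarterStep_nonneg m a, cfc_le_one _ _ fun s _ => quarterStep_le_one m s⟩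
  refine ⟨e, h.isStarProjection_of_isLUB_cfc_quarterStep ha he, he.2 ?_, ?_⟩
  · rintro _ ⟨m, rfl⟩
    rw [← cfc_const_mul_id 4 a]
    exact cfc_mono (fun s hs => quarterStep_le_four_mul m (spectrum_nonneg_of_nonneg h0 hs))
      (continuous_quarterStep m).continuousOn (by fun_prop)
  · rw [sub_le_iff_le_add]
    calc (τ a).re ≤ (τ (cfc (quarterStep 1) a)).re + 1 / 4 :=
          (re_map_mono τ (le_cfc_quarterStep_one_add h0 h1)).trans_eq (h.re_map_add_algebraMap _ _)
      _ ≤ (τ e).re + 1 / 4 := add_le_add_left (re_map_mono τ (he.1 ⟨1, rfl⟩)) _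

lemma exists_one_le_four_smul (h : IsFactorTrace τ) (h0 : 0 ≤ a) (h1 : a ≤ 1)
    (ha : 3 / 4 ≤ (τ a).re) :
    ∃ v : A, ‖v‖ ≤ 1 ∧ 1 ≤ (4 : ℝ) • (a + star v * a * v) := by
  obtain ⟨e, he, hea, hτ⟩ := h.exists_isStarProjection_le_four_smul h0 h1
  obtain ⟨v, hv, hve⟩ := h.exists_star_mul_mul_eq_one_sub e he (by linarith)
  refine ⟨v, hv, ?_⟩
  calc (1 : A) = e + star v * e * v := by rw [hve]; abel
    _ ≤ (4 : ℝ) • a + star v * ((4 : ℝ) • a) * v :=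
        add_le_add hea (star_left_conjugate_le_conjugate hea v)
    _ = _ := by rw [smul_add, mul_smul_comm, smul_mul_assoc]

end SpectralProjection

end IsFactorTrace

/-- The positive contractions `q` of trace at most `1 / 4` which are almost projections and almost
invariant under the given automorphisms, with errors relative to the trace of `q`. -/
structure IsAlmostInvariant {A : Type*} [CStarAlgebra A] [PartialOrder A] (τ : A →ₚ[ℂ] ℂ)
    {ι : Type*} (θ : ι → A ≃⋆ₐ[ℂ] A) (ε : ℝ) (q : A) : Prop where
  nonneg : 0 ≤ q
  le_one : q ≤ 1
  re_map_le : (τ q).re ≤ 1 / 4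
  defect_le : (τ q).re - l2Norm τ q ^ 2 ≤ ε * (τ q).re
  displacement_le : ∀ i, l2Norm τ (θ i q - q) ^ 2 ≤ ε * (τ q).re

/-- The nonzero positive contractions `y` of small 2-norm which almost commute with `F`, are almost
invariant under the given automorphisms and are almost projections, with errors relative to the
2-norm of `y`. -/
structure IsSmallAlmostProjection {A : Type*} [CStarAlgebra A] [PartialOrder A] (τ : A →ₚ[ℂ] ℂ)
    (F : Set A) {ι : Type*} (θ : ι → A ≃⋆ₐ[ℂ] A) (δ : ℝ) (y : A) : Prop where
  nonneg : 0 ≤ y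
  le_one : y ≤ 1
  l2Norm_pos : 0 < l2Norm τ y
  commutator_le : ∀ a ∈ F, l2Norm τ (a * y - y * a) ≤ δ * l2Norm τ y
  displacement_le : ∀ i, l2Norm τ (θ i y - y) ≤ δ * l2Norm τ y
  defect_le : l2Norm τ y ^ 2 - l2Norm τ (y * y) ^ 2 ≤ δ * l2Norm τ y ^ 2
  l2Norm_sq_le : l2Norm τ y ^ 2 ≤ δ

namespace IsFactorTrace

variable {A : Type*} [CStarAlgebra A] [PartialOrder A] [StarOrderedRing A] {τ : A →ₚ[ℂ] ℂ}
  {ι : Type*} {θ : ι → A ≃⋆ₐ[ℂ] A} {ε : ℝ}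

section UpperBound

variable {c : Set A} {q : A}

lemma exists_re_map_starAlgEquiv_sub_le (h : IsFactorTrace τ) (θ : A ≃⋆ₐ[ℂ] A)
    (hne : c.Nonempty) (hdir : DirectedOn (· ≤ ·) c) (hc : ∀ d ∈ c, 0 ≤ d) (hq : IsLUB c q)
    {κ : ℝ} (hκ : 0 < κ) : ∃ d ∈ c, (τ (θ (q - d))).re ≤ κ := by
  have hθ := h.isLUB_re_map (θ '' c) (θ q) (hne.image _)
    (hdir.mono_comp fun _ _ hxy => OrderHomClass.mono θ hxy)
    (by rintro _ ⟨x, hx, rfl⟩; exact starAlgEquiv_nonneg θ (hc x hx))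
    ((OrderIsoClass.toOrderIso θ).isLUB_image'.mpr hq)
  obtain ⟨_, ⟨_, ⟨d, hd, rfl⟩, rfl⟩, hlt, -⟩ := hθ.exists_between (sub_lt_self _ hκ)
  refine ⟨d, hd, ?_⟩
  rw [map_sub, map_sub, Complex.sub_re]
  linarith

lemma exists_l2Norm_sub_le (h : IsFactorTrace τ) (θ : A ≃⋆ₐ[ℂ] A) (hne : c.Nonempty)
    (hdir : DirectedOn (· ≤ ·) c) (hc : ∀ d ∈ c, 0 ≤ d) (hq : IsLUB c q) (hq1 : q ≤ 1)
    {κ : ℝ} (hκ : 0 < κ) :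
    ∃ d ∈ c, l2Norm τ (q - d) ≤ κ ∧ l2Norm τ (θ (q - d)) ≤ κ := by
  have hκ2 : 0 < κ ^ 2 := by positivity
  obtain ⟨d₁, hd₁, h₁⟩ :=
    h.exists_re_map_starAlgEquiv_sub_le (StarAlgEquiv.refl ℂ A) hne hdir hc hq hκ2
  obtain ⟨d₂, hd₂, h₂⟩ := h.exists_re_map_starAlgEquiv_sub_le θ hne hdir hc hq hκ2
  obtain ⟨d, hd, hd₁d, hd₂d⟩ := hdir d₁ hd₁ d₂ hd₂
  have hsub0 : 0 ≤ q - d := sub_nonneg.mpr (hq.1 hd)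
  have hsub1 : q - d ≤ 1 := (sub_le_self q (hc d hd)).trans hq1
  exact ⟨d, hd,
    h.l2Norm_le_of_re_le_sq hsub0 hsub1 hκ.le ((re_map_mono τ (sub_le_sub_left hd₁d q)).trans h₁),
    h.l2Norm_le_of_re_le_sq (starAlgEquiv_nonneg θ hsub0) (starAlgEquiv_le_one θ hsub1) hκ.le
      ((re_map_mono τ (OrderHomClass.mono θ (sub_le_sub_left hd₂d q))).trans h₂)⟩

lemma isAlmostInvariant_of_isLUB (h : IsFactorTrace τ) (hε : 0 ≤ ε) (hne : c.Nonempty)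
    (hdir : DirectedOn (· ≤ ·) c) (hc : ∀ d ∈ c, IsAlmostInvariant τ θ ε d) (hq : IsLUB c q) :
    IsAlmostInvariant τ θ ε q := by
  have hc0 (d) (hd : d ∈ c) : 0 ≤ d := (hc d hd).nonneg
  have hq0 : 0 ≤ q := hne.elim fun d hd => (hc0 d hd).trans (hq.1 hd)
  have hq1 : q ≤ 1 := hq.2 fun d hd => (hc d hd).le_one
  have hτle (d) (hd : d ∈ c) : ε * (τ d).re ≤ ε * (τ q).re :=
    mul_le_mul_of_nonneg_left (re_map_mono τ (hq.1 hd)) hε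
  have hlub := h.isLUB_re_map c q hne hdir hc0 hq
  refine ⟨hq0, hq1, hlub.2 ?_, le_of_forall_pos_le_add fun κ hκ => ?_, fun i => ?_⟩
  · rintro _ ⟨d, hd, rfl⟩
    exact (hc d hd).re_map_le
  · obtain ⟨_, ⟨d, hd, rfl⟩, hlt, -⟩ := hlub.exists_between (sub_lt_self _ hκ)
    have hsq := h.re_map_mul_self_mono (hc0 d hd) (hq.1 hd)
    rw [← l2Norm_sq_of_isSelfAdjoint τ (.of_nonneg (hc0 d hd)),
      ← l2Norm_sq_of_isSelfAdjoint τ (.of_nonneg hq0)] at hsq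
    linarith [(hc d hd).defect_le, hτle d hd]
  · refine (Real.le_sqrt (l2Norm_nonneg τ _) (mul_nonneg hε (re_map_nonneg τ hq0))).mp ?_
    refine le_of_forall_pos_le_add fun κ hκ => ?_
    obtain ⟨d, hd, hqd, hθqd⟩ := h.exists_l2Norm_sub_le (θ i) hne hdir hc0 hq hq1 (half_pos hκ)
    have hd_le : l2Norm τ (θ i d - d) ≤ √(ε * (τ q).re) :=
      Real.le_sqrt_of_sq_le (((hc d hd).displacement_le i).trans (hτle d hd))
    have e : θ i q - q = (θ i d - d) + θ i (q - d) - (q - d) := by rw [map_sub]; abel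
    rw [e]
    linarith [l2Norm_sub_le τ ((θ i d - d) + θ i (q - d)) (q - d),
      l2Norm_add_le τ (θ i d - d) (θ i (q - d))]

lemma exists_isAlmostInvariant_upperBound (h : IsFactorTrace τ) (hε : 0 ≤ ε)
    (hc : ∀ d ∈ c, IsAlmostInvariant τ θ ε d) (hchain : IsChain (· ≤ ·) c) :
    ∃ q, IsAlmostInvariant τ θ ε q ∧ ∀ d ∈ c, d ≤ q := by
  rcases c.eq_empty_or_nonempty with rfl | hne
  · exact ⟨0, ⟨le_rfl, zero_le_one, by simp, by simp [l2Norm_zero], by simp [l2Norm_zero]⟩,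
      by simp⟩
  · obtain ⟨q, hq⟩ := h.exists_isLUB c hne hchain.directedOn
      fun d hd => ⟨(hc d hd).nonneg, (hc d hd).le_one⟩
    exact ⟨q, h.isAlmostInvariant_of_isLUB hε hne hchain.directedOn hc hq, fun d hd => hq.1 hd⟩

end UpperBound

section Patching

variable {q r y : A} {F : Set A} {δ : ℝ}

lemma isAlmostInvariant_extension (h : IsTracialState τ) (hq : IsAlmostInvariant τ θ ε q)
    (hτq : (τ q).re ≤ 1 / 8) (hr : IsSelfAdjoint r) (hrq : r * r = 1 - q)
    (hy : IsSmallAlmostProjection τ F θ δ y) (hrF : r ∈ F) (hθF : ∀ i, θ i r ∈ F)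
    (hδ1 : δ ≤ 1 / 8) (hδε : 10000 * δ ≤ ε) (hlow : l2Norm τ y ≤ 8 * l2Norm τ (r * y)) :
    IsAlmostInvariant τ θ ε (q + r * (y * y) * r) := by
  have hys : IsSelfAdjoint y := .of_nonneg hy.nonneg
  have hn := hy.l2Norm_pos
  have hyy1 : y * y ≤ 1 := (mul_self_le_self_of_le_one hy.nonneg hy.le_one).trans hy.le_one
  have hP0 : 0 ≤ r * (y * y) * r := by
    simpa only [hr.star_eq] using star_left_conjugate_nonneg hys.mul_self_nonneg r
  have hP1 : r * (y * y) * r ≤ r * 1 * r := by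
    simpa only [hr.star_eq] using star_left_conjugate_le_conjugate hyy1 r
  have hτ := h.re_map_add_mul_mul_self_mul hr hys q
  have hrn := norm_le_one_of_mul_self_eq_one_sub hr hrq hq.nonneg hq.le_one
  have hgain : 150 * δ * l2Norm τ y ^ 2 ≤ ε * l2Norm τ (r * y) ^ 2 := by
    have hsq := pow_le_pow_left₀ hn.le hlow 2
    nlinarith [mul_le_mul_of_nonneg_right hδε (sq_nonneg (l2Norm τ y)),
      hy.l2Norm_sq_le, sq_nonneg (l2Norm τ y)]
  have hδ0 : 0 ≤ δ := (sq_nonneg _).trans hy.l2Norm_sq_le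
  have hry := hy.commutator_le r hrF
  refine ⟨add_nonneg hq.nonneg hP0, ?_, ?_, ?_, fun i => ?_⟩
  · calc q + r * (y * y) * r ≤ q + r * 1 * r := add_le_add_right hP1 q
      _ = 1 := by rw [mul_one, hrq]; abel
  · have hup : l2Norm τ (r * y) ^ 2 ≤ 1 / 8 :=
      (pow_le_pow_left₀ (l2Norm_nonneg τ _) (l2Norm_mul_le_of_norm_le_one τ hrn y) 2).trans
        (hy.l2Norm_sq_le.trans hδ1)
    linarith
  · have := h.extension_defect_le hq.nonneg hq.le_one hr hrq hy.nonneg hy.le_one hry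
      (hy.defect_le.trans_eq (by ring))
    rw [hτ] at this ⊢
    nlinarith [hq.defect_le, mul_nonneg hδ0 (sq_nonneg (l2Norm τ y))]
  · have := h.extension_displacement_le (θ i) (mul_le_of_le_one_left hn.le (by linarith))
      hq.nonneg hq.le_one hr hrq hy.nonneg hy.le_one hry (hy.commutator_le _ (hθF i))
      (hy.displacement_le i)
    rw [hτ]
    nlinarith [hq.displacement_le i]

variable [Finite ι]

lemma exists_isAlmostInvariant_re_map_lt (h : IsFactorTrace τ) (hε : 0 < ε)
    (hsmall : ∀ F : Set A, F.Finite → ∀ δ > 0, ∃ y, IsSmallAlmostProjection τ F θ δ y)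
    (hq : IsAlmostInvariant τ θ ε q) (hτq : (τ q).re < 1 / 8) :
    ∃ q', IsAlmostInvariant τ θ ε q' ∧ q ≤ q' ∧ (τ q).re < (τ q').re := by
  have hq0 : 0 ≤ 1 - q := sub_nonneg.mpr hq.le_one
  obtain ⟨v, hv, hqv⟩ := h.exists_one_le_four_smul hq0 (sub_le_self 1 hq.nonneg) <| by
    rw [map_sub, Complex.sub_re, h.map_one, Complex.one_re]; linarith
  set r := CFC.sqrt (1 - q)
  have hrq : r * r = 1 - q := CFC.sqrt_mul_sqrt_self (1 - q) hq0
  have hr : IsSelfAdjoint r := .of_nonneg (CFC.sqrt_nonneg _)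
  have hrn := norm_le_one_of_mul_self_eq_one_sub hr hrq hq.nonneg hq.le_one
  obtain ⟨y, hy⟩ := hsmall ({r, v} ∪ Set.range fun i => θ i r)
    ((Set.toFinite _).union (Set.finite_range _)) (min (1 / 8) (ε / 10000)) (by positivity)
  have hlow := h.l2Norm_le_of_almost_commute hr hrn hv (hrq ▸ hqv) <|
    (hy.commutator_le v (by simp)).trans <|
      mul_le_mul_of_nonneg_right (min_le_left _ _) hy.l2Norm_pos.le
  have hys : IsSelfAdjoint y := .of_nonneg hy.nonneg
  refine ⟨q + r * (y * y) * r,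
    isAlmostInvariant_extension h.toIsTracialState hq hτq.le hr hrq hy (by simp) (by simp)
      (min_le_left _ _) (by linarith [min_le_right (1 / 8) (ε / 10000)]) hlow,
    le_add_of_nonneg_right ?_, ?_⟩
  · simpa only [hr.star_eq] using star_left_conjugate_nonneg hys.mul_self_nonneg r
  · have hpos : 0 < l2Norm τ (r * y) := by linarith [hy.l2Norm_pos]
    rw [h.re_map_add_mul_mul_self_mul hr hys]
    exact lt_add_of_pos_right _ (by positivity)

theorem exists_isAlmostInvariant_of_small (h : IsFactorTrace τ) (hε : 0 < ε)
    (hsmall : ∀ F : Set A, F.Finite → ∀ δ > 0, ∃ y, IsSmallAlmostProjection τ F θ δ y) :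
    ∃ q, IsAlmostInvariant τ θ ε q ∧ 1 / 8 ≤ (τ q).re := by
  obtain ⟨q, hqmax⟩ := zorn_le₀ {q | IsAlmostInvariant τ θ ε q} fun c hc hchain =>
    h.exists_isAlmostInvariant_upperBound hε.le hc hchain
  refine ⟨q, hqmax.1, ?_⟩
  by_contra! hlt
  obtain ⟨q', hq', hle, hτ⟩ := h.exists_isAlmostInvariant_re_map_lt hε hsmall hqmax.1 hlt
  exact absurd (re_map_mono τ (hqmax.2 hq' hle)) (not_le.mpr hτ)

end Patching

end IsFactorTrace

/-! ### From almost fixed elements to a spectral gap -/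

/-- Truncation of a real number to the interval `[-C, C]`. -/
noncomputable def clip (C s : ℝ) : ℝ := max (-C) (min s C)

section Clip

variable {C : ℝ}

lemma lipschitzWith_clip (C : ℝ) : LipschitzWith 1 (clip C) :=
  (LipschitzWith.id.min_const C).const_max (-C)

lemma abs_clip_le (hC : 0 ≤ C) (s : ℝ) : |clip C s| ≤ C :=
  abs_le.mpr ⟨le_max_left _ _, max_le (by linarith) (min_le_right _ _)⟩

lemma clip_of_le_neg (hC : 0 ≤ C) {s : ℝ} (hs : s ≤ -C) : clip C s = -C := by
  rw [clip, min_eq_left (by linarith), max_eq_left hs]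

lemma clip_of_abs_le {s : ℝ} (hs : |s| ≤ C) : clip C s = s := by
  rw [clip, min_eq_left (abs_le.mp hs).2, max_eq_right (abs_le.mp hs).1]

lemma clip_of_ge (hC : 0 ≤ C) {s : ℝ} (hs : C ≤ s) : clip C s = C := by
  rw [clip, min_eq_right hs, max_eq_right (by linarith)]

lemma abs_clip (hC : 0 ≤ C) (s : ℝ) : |clip C s| = min |s| C := by
  rcases le_total |s| C with hs | hs
  · rw [clip_of_abs_le hs, min_eq_left hs]
  rw [min_eq_right hs]
  rcases le_abs.mp hs with hs | hs
  · rw [clip_of_ge hC hs, abs_of_nonneg hC]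
  · rw [clip_of_le_neg hC (le_neg_of_le_neg hs), abs_neg, abs_of_nonneg hC]

lemma abs_clip_sub_le (hC : 0 < C) (s : ℝ) : |clip C s - s| ≤ C⁻¹ * (s * s) := by
  rw [inv_mul_eq_div, le_div_iff₀ hC]
  rcases le_total |s| C with hs | hs
  · rw [clip_of_abs_le hs, sub_self, abs_zero, zero_mul]
    exact mul_self_nonneg s
  rcases le_abs.mp hs with hs | hs
  · rw [clip_of_ge hC.le hs, abs_of_nonpos (by linarith)]
    nlinarith
  · rw [clip_of_le_neg hC.le (le_neg_of_le_neg hs), abs_of_nonneg (by linarith)]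
    nlinarith

end Clip

lemma starAlgEquiv_cfc {A : Type*} [CStarAlgebra A] (θ : A ≃⋆ₐ[ℂ] A) {φ : ℝ → ℝ}
    (hφ : Continuous φ) {x : A} (hx : IsSelfAdjoint x) : θ (cfc φ x) = cfc φ (θ x) :=
  StarAlgHomClass.map_cfc θ φ x hφ.continuousOn (StarAlgEquiv.isometry θ).continuous hx (hx.map θ)

/-- Elements of bounded norm which are almost fixed by the automorphisms `T j` are close to
scalars. -/
def AlmostFixedAreScalar {A : Type*} [CStarAlgebra A] [PartialOrder A] (τ : A →ₚ[ℂ] ℂ) {Λ : Type*}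
    (T : Λ → A ≃⋆ₐ[ℂ] A) : Prop :=
  ∀ ε > 0, ∀ C : ℝ, ∃ J : Finset Λ, ∃ δ > 0, ∀ x : A, ‖x‖ ≤ C →
    (∀ j ∈ J, l2Norm τ (T j x - x) ≤ δ) → l2Norm τ (x - τ x • 1) ≤ ε

/-- Commutators with a fixed element are controlled, in 2-norm and uniformly in the other argument,
by finitely many of the displacements of the automorphisms `T j`. -/
def ControlsCommutators {A : Type*} [CStarAlgebra A] [PartialOrder A] (τ : A →ₚ[ℂ] ℂ) {Λ : Type*}
    (T : Λ → A ≃⋆ₐ[ℂ] A) : Prop :=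
  ∀ a : A, ∃ J : Finset Λ, ∃ C : ℝ, ∀ y : A,
    l2Norm τ (a * y - y * a) ≤ C * ∑ j ∈ J, l2Norm τ (T j y - y)

/-- The distance to the scalars is controlled, in 2-norm and without any bound on the operator
norm, by finitely many of the displacements of the automorphisms `T j`. -/
def HasSpectralGap {A : Type*} [CStarAlgebra A] [PartialOrder A] (τ : A →ₚ[ℂ] ℂ) {Λ : Type*}
    (T : Λ → A ≃⋆ₐ[ℂ] A) : Prop :=
  ∃ (J : Finset Λ) (κ : ℝ), 0 < κ ∧
    ∀ x : A, l2Norm τ (x - τ x • 1) ≤ κ * ∑ j ∈ J, l2Norm τ (T j x - x)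

lemma map_eq_re_of_isSelfAdjoint {A : Type*} [CStarAlgebra A] [PartialOrder A] [StarOrderedRing A]
    (τ : A →ₚ[ℂ] ℂ) {x : A} (hx : IsSelfAdjoint x) : τ x = ((τ x).re : ℂ) :=
  (Complex.conj_eq_iff_re.mp (hx.map τ)).symm

namespace IsTracialState

variable {A : Type*} [CStarAlgebra A] [PartialOrder A] [StarOrderedRing A] {τ : A →ₚ[ℂ] ℂ}

lemma l2Norm_realPart_le (h : IsTracialState τ) (x : A) :
    l2Norm τ (realPart x : A) ≤ l2Norm τ x := by
  have hadd := l2Norm_add_le τ x (star x)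
  rw [h.l2Norm_star] at hadd
  rw [realPart_apply_coe, ← Complex.coe_smul, l2Norm_smul, Complex.norm_real,
    Real.norm_of_nonneg (by positivity)]
  linarith

lemma l2Norm_le_sub_add_norm_map (h : IsTracialState τ) (x : A) :
    l2Norm τ x ≤ l2Norm τ (x - τ x • 1) + ‖τ x‖ := by
  simpa [l2Norm_smul, h.l2Norm_one] using l2Norm_add_le τ (x - τ x • 1) (τ x • 1)

lemma l2Norm_sub_map_smul_one_sq (h : IsTracialState τ) {x : A} (hx : IsSelfAdjoint x) :
    l2Norm τ (x - τ x • 1) ^ 2 = l2Norm τ x ^ 2 - (τ x).re ^ 2 := by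
  have hs : IsSelfAdjoint ((τ x).re • (1 : A)) := (IsSelfAdjoint.all _).smul (.one A)
  rw [map_eq_re_of_isSelfAdjoint τ hx, Complex.coe_smul, sub_eq_add_neg,
    h.l2Norm_add_sq hx hs.neg, l2Norm_neg,
    ← Complex.coe_smul, l2Norm_smul, h.l2Norm_one, Complex.norm_real, Real.norm_eq_abs, mul_one,
    sq_abs, Complex.ofReal_re, Complex.coe_smul, mul_neg, mul_smul_comm, mul_one, map_neg,
    Complex.neg_re, re_map_smul]
  ring

lemma l2Norm_cfc_sub_cfc_le (h : IsTracialState τ) {φ : ℝ → ℝ} (hφ : LipschitzWith 1 φ) {a b : A}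
    (ha : IsSelfAdjoint a) (hb : IsSelfAdjoint b) :
    l2Norm τ (cfc φ a - cfc φ b) ≤ l2Norm τ (a - b) := by
  have hsq := h.sum_l2Norm_cfc_sub_cfc_sq_le {()} (f := fun _ => φ) (fun _ => hφ.continuous)
    (fun s t => by simpa [Real.dist_eq, sq_le_sq] using hφ.dist_le_mul s t) ha hb
  rw [Finset.sum_singleton] at hsq
  exact (pow_le_pow_iff_left₀ (l2Norm_nonneg τ _) (l2Norm_nonneg τ _) two_ne_zero).mp hsq

section Heights

variable {x : A}

lemma norm_map_cfc_clip_le (hx : IsSelfAdjoint x) (hτ : τ x = 0) (hx1 : l2Norm τ x = 1) {C : ℝ}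
    (hC : 0 < C) : ‖τ (cfc (clip C) x)‖ ≤ C⁻¹ := by
  have hcl := (lipschitzWith_clip C).continuous
  have hsub : τ (cfc (clip C) x) = τ (cfc (fun s => clip C s - s) x) := by
    rw [cfc_sub _ _ x hcl.continuousOn (by fun_prop), cfc_id' ℝ x, map_sub, hτ, sub_zero]
  have hsq : (τ (cfc (fun s : ℝ => C⁻¹ * (s * s)) x)).re = C⁻¹ := by
    rw [cfc_const_mul _ _ x (by fun_prop), re_map_smul, ← l2Norm_cfc_sq τ continuous_id' x,
      cfc_id' ℝ x, hx1, one_pow, mul_one]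
  have hneg := re_map_cfc_mono τ (φ := fun s => -(clip C s - s)) (ψ := fun s => C⁻¹ * (s * s))
    (x := x) (by fun_prop) (by fun_prop)
    fun s _ => neg_le.mp (neg_le_of_abs_le (abs_clip_sub_le hC s))
  have hpos := re_map_cfc_mono τ (φ := fun s => clip C s - s) (ψ := fun s => C⁻¹ * (s * s))
    (x := x) (by fun_prop) (by fun_prop) fun s _ => le_of_abs_le (abs_clip_sub_le hC s)
  rw [cfc_neg, map_neg, Complex.neg_re, hsq] at hneg
  rw [hsq] at hpos
  rw [hsub, map_eq_re_of_isSelfAdjoint τ (cfc_predicate _ x), Complex.norm_real]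
  exact abs_le'.mpr ⟨hpos, hneg⟩

lemma l2Norm_cfc_min_abs_one_le_clip (x : A) {C : ℝ} (hC : 1 ≤ C) :
    l2Norm τ (cfc (fun s : ℝ => min |s| 1) x) ≤ l2Norm τ (cfc (clip C) x) := by
  have hcl := (lipschitzWith_clip C).continuous
  refine (pow_le_pow_iff_left₀ (l2Norm_nonneg τ _) (l2Norm_nonneg τ _) two_ne_zero).mp ?_
  rw [l2Norm_cfc_sq τ (by fun_prop), l2Norm_cfc_sq τ hcl]
  refine re_map_cfc_mono τ (by fun_prop) (by fun_prop) fun s _ => ?_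
  rw [← abs_mul_abs_self (clip C s), abs_clip (by linarith)]
  exact mul_self_le_mul_self (by positivity) (min_le_min_left _ hC)

/-- The truncation is close to its trace, which is small because `τ x = 0`: most of the mass of `x`
sits at large heights. -/
lemma l2Norm_cfc_min_abs_one_le (h : IsTracialState τ) (hx : IsSelfAdjoint x) (hτ : τ x = 0)
    (hx1 : l2Norm τ x = 1) {C : ℝ} (hC : 1 ≤ C) :
    l2Norm τ (cfc (fun s : ℝ => min |s| 1) x) ≤
      l2Norm τ (cfc (clip C) x - τ (cfc (clip C) x) • 1) + C⁻¹ :=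
  calc l2Norm τ (cfc (fun s : ℝ => min |s| 1) x) ≤ l2Norm τ (cfc (clip C) x) :=
        l2Norm_cfc_min_abs_one_le_clip x hC
    _ ≤ _ := (h.l2Norm_le_sub_add_norm_map _).trans <|
        add_le_add_right (norm_map_cfc_clip_le hx hτ hx1 (by linarith)) _

lemma l2Norm_cfc_sq_sub_le {φ : ℝ → ℝ} (hφ : Continuous φ) (h01 : ∀ s, 0 ≤ φ s ∧ φ s ≤ 1)
    (x : A) :
    l2Norm τ (cfc φ x) ^ 2 - l2Norm τ (cfc φ x * cfc φ x) ^ 2 ≤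
      2 * ((τ (cfc φ x)).re - l2Norm τ (cfc φ x) ^ 2) := by
  have hφ2 : Continuous fun s => φ s * φ s := hφ.mul hφ
  have hmono := re_map_cfc_mono τ (x := x) (φ := fun s => φ s * φ s + 2 * (φ s * φ s))
    (ψ := fun s => 2 * φ s + φ s * φ s * (φ s * φ s)) (by fun_prop) (by fun_prop) fun s _ => by
      obtain ⟨h0, h1⟩ := h01 s
      nlinarith [mul_nonneg (mul_nonneg h0 (sub_nonneg.mpr h1)) (sub_nonneg.mpr h1),
        mul_nonneg (mul_nonneg h0 h0) (mul_nonneg (sub_nonneg.mpr h1) (sub_nonneg.mpr h1)),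
        mul_nonneg h0 (sub_nonneg.mpr h1)]
  rw [cfc_add x _ _ hφ2.continuousOn (by fun_prop), cfc_add x _ _ (by fun_prop) (by fun_prop),
    cfc_const_mul _ _ x hφ2.continuousOn, cfc_const_mul _ _ x hφ.continuousOn, map_add, map_add,
    Complex.add_re, Complex.add_re, re_map_smul, re_map_smul] at hmono
  rw [← cfc_mul φ φ x hφ.continuousOn hφ.continuousOn, l2Norm_cfc_sq τ hφ, l2Norm_cfc_sq τ hφ2]
  linarith

end Heights

variable {Λ : Type*} {T : Λ → A ≃⋆ₐ[ℂ] A}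

section Witness

variable {J : Finset Λ} {δ : ℝ} {x : A}

lemma exists_isSelfAdjoint_of_le_realPart (h : IsTracialState τ) (hτ : τ x = 0)
    (hx : 0 < l2Norm τ x) (hre : l2Norm τ x / 2 ≤ l2Norm τ (realPart x : A)) (hδ : 0 ≤ δ)
    (hT : ∀ j ∈ J, l2Norm τ (T j x - x) ≤ δ * (l2Norm τ x / 2)) :
    ∃ w : A, IsSelfAdjoint w ∧ τ w = 0 ∧ l2Norm τ w = 1 ∧ ∀ j ∈ J, l2Norm τ (T j w - w) ≤ δ := by
  set M := l2Norm τ (realPart x : A)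
  have hM : 0 < M := (half_pos hx).trans_le hre
  have hM' : ‖((M⁻¹ : ℝ) : ℂ)‖ = M⁻¹ := by
    rw [Complex.norm_real, Real.norm_of_nonneg (by positivity)]
  refine ⟨((M⁻¹ : ℝ) : ℂ) • (realPart x : A), ?_, ?_, ?_, fun j hj => ?_⟩
  · rw [Complex.coe_smul]
    exact (IsSelfAdjoint.all _).smul (realPart x).2
  · rw [map_smul, map_realPart τ, hτ, map_zero, ZeroMemClass.coe_zero, smul_zero]
  · rw [l2Norm_smul, hM', inv_mul_cancel₀ hM.ne']
  · rw [map_smul, ← smul_sub, l2Norm_smul, hM', inv_mul_le_iff₀ hM]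
    calc l2Norm τ (T j (realPart x : A) - realPart x)
        = l2Norm τ (realPart (T j x - x) : A) := by
          rw [map_realPart (T j), map_sub, AddSubgroupClass.coe_sub]
      _ ≤ δ * (l2Norm τ x / 2) := (h.l2Norm_realPart_le _).trans (hT j hj)
      _ ≤ M * δ := by rw [mul_comm M]; exact mul_le_mul_of_nonneg_left hre hδ

lemma exists_isSelfAdjoint_of_lt (h : IsTracialState τ) (hδ : 0 < δ)
    (hx : 2 / δ * ∑ j ∈ J, l2Norm τ (T j x - x) < l2Norm τ (x - τ x • 1)) :
    ∃ w : A, IsSelfAdjoint w ∧ τ w = 0 ∧ l2Norm τ w = 1 ∧ ∀ j ∈ J, l2Norm τ (T j w - w) ≤ δ := by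
  set z := x - τ x • (1 : A) with hz
  have hτz : τ z = 0 := by simp [hz, h.map_one]
  have hTz (j : Λ) : T j z - z = T j x - x := by
    rw [hz, map_sub, map_smul, map_one]; abel
  have hzpos : 0 < l2Norm τ z := lt_of_le_of_lt
    (mul_nonneg (by positivity) (Finset.sum_nonneg fun j _ => l2Norm_nonneg τ _)) hx
  have hTz_le (j) (hj : j ∈ J) : l2Norm τ (T j z - z) ≤ δ * (l2Norm τ z / 2) := by
    have hsingle := Finset.single_le_sum (f := fun j => l2Norm τ (T j x - x))
      (fun i _ => l2Norm_nonneg τ _) hj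
    rw [div_mul_eq_mul_div, div_lt_iff₀ hδ] at hx
    rw [hTz]
    linarith
  -- The imaginary part of `z` is, up to sign, the real part of `I • z`.
  have hI (w : A) : l2Norm τ (Complex.I • w) = l2Norm τ w := by
    rw [l2Norm_smul, Complex.norm_I, one_mul]
  rcases le_or_gt (l2Norm τ z / 2) (l2Norm τ (realPart z : A)) with hre | hre
  · exact h.exists_isSelfAdjoint_of_le_realPart hτz hzpos hre hδ.le hTz_le
  · have him : l2Norm τ z ≤ l2Norm τ (realPart z : A) + l2Norm τ (imaginaryPart z : A) := by
      simpa only [realPart_add_I_smul_imaginaryPart, hI] using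
        l2Norm_add_le τ (realPart z : A) (Complex.I • (imaginaryPart z : A))
    refine h.exists_isSelfAdjoint_of_le_realPart (x := Complex.I • z) (by simp [hτz])
      (by rwa [hI]) ?_ hδ.le fun j hj => by simpa only [map_smul, ← smul_sub, hI] using hTz_le j hj
    rw [realPart_I_smul, NegMemClass.coe_neg, l2Norm_neg, hI]
    linarith

end Witness

section NoSpectralGap

lemma exists_isSelfAdjoint_of_not_hasSpectralGap (h : IsTracialState τ)
    (hT : AlmostFixedAreScalar τ T) (hgap : ¬ HasSpectralGap τ T) (J : Finset Λ) {ε : ℝ}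
    (hε : 0 < ε) :
    ∃ x : A, IsSelfAdjoint x ∧ l2Norm τ x = 1 ∧ l2Norm τ (cfc (fun s : ℝ => min |s| 1) x) ≤ ε ∧
      ∀ j ∈ J, l2Norm τ (T j x - x) ≤ ε := by
  classical
  set C := max 1 (2 / ε)
  have hC1 : 1 ≤ C := le_max_left _ _
  have hCε : C⁻¹ ≤ ε / 2 := by
    rw [← inv_div]; exact inv_anti₀ (by positivity) (le_max_right _ _)
  obtain ⟨J', δ, hδ, hscal⟩ := hT (ε / 2) (half_pos hε) C
  have hm : 0 < min δ ε := lt_min hδ hε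
  obtain ⟨x₀, hx₀⟩ : ∃ x : A, 2 / min δ ε * ∑ j ∈ J ∪ J', l2Norm τ (T j x - x) <
      l2Norm τ (x - τ x • 1) := by
    by_contra! hle
    exact hgap ⟨J ∪ J', 2 / min δ ε, by positivity, hle⟩
  obtain ⟨x, hx, hτ, hx1, hTx⟩ := h.exists_isSelfAdjoint_of_lt hm hx₀
  refine ⟨x, hx, hx1, ?_, fun j hj =>
    (hTx j (Finset.mem_union_left _ hj)).trans (min_le_right _ _)⟩
  have hclip : l2Norm τ (cfc (clip C) x - τ (cfc (clip C) x) • 1) ≤ ε / 2 := by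
    refine hscal _ (norm_cfc_le (by linarith) fun s _ => abs_clip_le (by linarith) s)
      fun j hj => ?_
    rw [starAlgEquiv_cfc (T j) (lipschitzWith_clip C).continuous hx]
    exact (h.l2Norm_cfc_sub_cfc_le (lipschitzWith_clip C) (hx.map (T j)) hx).trans
      ((hTx j (Finset.mem_union_right _ hj)).trans (min_le_left _ _))
  linarith [h.l2Norm_cfc_min_abs_one_le hx hτ hx1 hC1]

lemma exists_isSmallAlmostProjection_empty (h : IsTracialState τ) (hT : AlmostFixedAreScalar τ T)
    (hgap : ¬ HasSpectralGap τ T) (J : Finset Λ) {δ : ℝ} (hδ : 0 < δ) :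
    ∃ y, IsSmallAlmostProjection τ ∅ (fun j : J => T j) δ y := by
  obtain ⟨d, hd, hd2, hdδ⟩ : ∃ d > 0, d ≤ δ ^ 2 ∧ 2 * d ≤ δ :=
    ⟨min (δ ^ 2) (δ / 2), by positivity, min_le_left _ _,
      by linarith [min_le_right (δ ^ 2) (δ / 2)]⟩
  obtain ⟨ε, hε, hcut⟩ := h.exists_cutoff J hd
  have hsqrt {t : ℝ} (h0 : 0 ≤ t) (ht : t ≤ √ε) : t ^ 2 ≤ ε := (Real.le_sqrt h0 hε.le).mp ht
  obtain ⟨x, hx, hx1, hxε, hxT⟩ :=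
    h.exists_isSelfAdjoint_of_not_hasSpectralGap hT hgap J (Real.sqrt_pos.mpr hε)
  obtain ⟨φ, hφ, hφ01, hpos, hφT, hφd, hφs⟩ := hcut x (fun j => T j x) hx
    (fun j => hx.map (T j)) hx1 (hsqrt (l2Norm_nonneg τ _) hxε)
    (fun j => hsqrt (l2Norm_nonneg τ _) (hxT j j.2))
  refine ⟨cfc φ x, cfc_nonneg fun s _ => (hφ01 s).1, cfc_le_one _ _ fun s _ => (hφ01 s).2, hpos,
    fun a ha => ha.elim, fun j => ?_, ?_, by linarith⟩
  · rw [starAlgEquiv_cfc (T j) hφ hx]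
    refine (pow_le_pow_iff_left₀ (l2Norm_nonneg τ _) (by positivity) two_ne_zero).mp ?_
    rw [mul_pow]
    exact (hφT j).trans (mul_le_mul_of_nonneg_right hd2 (sq_nonneg _))
  · have hdefect := l2Norm_cfc_sq_sub_le (τ := τ) hφ hφ01 x
    have hdδ' := mul_le_mul_of_nonneg_right hdδ (sq_nonneg (l2Norm τ (cfc φ x)))
    linarith

end NoSpectralGap

end IsTracialState

namespace ControlsCommutators

variable {A : Type*} [CStarAlgebra A] [PartialOrder A] {τ : A →ₚ[ℂ] ℂ} {Λ : Type*}
  {T : Λ → A ≃⋆ₐ[ℂ] A}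

lemma exists_of_finite (hT : ControlsCommutators τ T) {F : Set A} (hF : F.Finite) :
    ∃ J : Finset Λ, ∃ C : ℝ, 0 ≤ C ∧ ∀ a ∈ F, ∀ y : A,
      l2Norm τ (a * y - y * a) ≤ C * ∑ j ∈ J, l2Norm τ (T j y - y) := by
  classical
  choose J C hJC using hT
  have hC : ∀ b ∈ hF.toFinset, 0 ≤ |C b| := fun b _ => abs_nonneg _
  refine ⟨hF.toFinset.biUnion J, ∑ b ∈ hF.toFinset, |C b|, Finset.sum_nonneg hC,
    fun a ha y => (hJC a y).trans ?_⟩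
  have ha' := hF.mem_toFinset.mpr ha
  have hT0 (s : Finset Λ) : 0 ≤ ∑ j ∈ s, l2Norm τ (T j y - y) :=
    Finset.sum_nonneg fun j _ => l2Norm_nonneg τ _
  refine mul_le_mul ((le_abs_self _).trans (Finset.single_le_sum hC ha')) ?_ (hT0 _)
    (Finset.sum_nonneg hC)
  exact Finset.sum_le_sum_of_subset_of_nonneg (Finset.subset_biUnion_of_mem J ha')
    fun j _ _ => l2Norm_nonneg τ _

lemma exists_forall_commutator_le (hT : ControlsCommutators τ T) {F : Set A} (hF : F.Finite)
    {δ : ℝ} (hδ : 0 < δ) :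
    ∃ J : Finset Λ, ∃ δ' > 0, ∀ (y : A) (n : ℝ), 0 ≤ n →
      (∀ j ∈ J, l2Norm τ (T j y - y) ≤ δ' * n) → ∀ a ∈ F, l2Norm τ (a * y - y * a) ≤ δ * n := by
  obtain ⟨J, C, hC, hJC⟩ := hT.exists_of_finite hF
  refine ⟨J, δ / (C * J.card + 1), by positivity, fun y n hn hy a ha => ?_⟩
  calc l2Norm τ (a * y - y * a) ≤ C * ∑ j ∈ J, l2Norm τ (T j y - y) := hJC a ha y
    _ ≤ C * (J.card * (δ / (C * J.card + 1) * n)) := by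
      refine mul_le_mul_of_nonneg_left ?_ hC
      simpa only [nsmul_eq_mul] using Finset.sum_le_card_nsmul _ _ _ hy
    _ = C * J.card * (δ / (C * J.card + 1) * n) := by ring
    _ ≤ (C * J.card + 1) * (δ / (C * J.card + 1) * n) :=
      mul_le_mul_of_nonneg_right (le_add_of_nonneg_right zero_le_one) (by positivity)
    _ = δ * n := by field_simp

end ControlsCommutators

section SpectralGap

variable {A : Type*} [CStarAlgebra A] [PartialOrder A] [StarOrderedRing A] {τ : A →ₚ[ℂ] ℂ}
  {Λ : Type*} {T : Λ → A ≃⋆ₐ[ℂ] A}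

lemma IsTracialState.exists_isSmallAlmostProjection (h : IsTracialState τ)
    (hT : AlmostFixedAreScalar τ T) (hcomm : ControlsCommutators τ T)
    (hgap : ¬ HasSpectralGap τ T) (J : Finset Λ) {F : Set A} (hF : F.Finite) {δ : ℝ}
    (hδ : 0 < δ) : ∃ y, IsSmallAlmostProjection τ F (fun j : J => T j) δ y := by
  classical
  obtain ⟨J', δ', hδ', hF'⟩ := hcomm.exists_forall_commutator_le hF hδ
  obtain ⟨y, hy⟩ := h.exists_isSmallAlmostProjection_empty hT hgap (J ∪ J') (lt_min hδ hδ')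
  have hm := min_le_left δ δ'
  have hn := hy.l2Norm_pos.le
  refine ⟨y, hy.nonneg, hy.le_one, hy.l2Norm_pos, hF' y _ hn fun j hj => ?_, fun j => ?_,
    hy.defect_le.trans (mul_le_mul_of_nonneg_right hm (sq_nonneg _)), hy.l2Norm_sq_le.trans hm⟩
  · exact (hy.displacement_le ⟨j, Finset.mem_union_right _ hj⟩).trans
      (mul_le_mul_of_nonneg_right (min_le_right _ _) hn)
  · exact (hy.displacement_le ⟨j, Finset.mem_union_left _ j.2⟩).trans
      (mul_le_mul_of_nonneg_right hm hn)

theorem IsFactorTrace.hasSpectralGap (h : IsFactorTrace τ) (hT : AlmostFixedAreScalar τ T)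
    (hcomm : ControlsCommutators τ T) : HasSpectralGap τ T := by
  by_contra hgap
  obtain ⟨J, δ, hδ, hscal⟩ := hT (1 / 8) (by norm_num) 1
  obtain ⟨q, hq, hτq⟩ := h.exists_isAlmostInvariant_of_small (θ := fun j : J => T j)
    (ε := min (δ ^ 2) (1 / 4)) (by positivity)
    fun F hF δ' hδ' => h.exists_isSmallAlmostProjection hT hcomm hgap J hF hδ'
  have hτq4 := hq.re_map_le
  have hclose : l2Norm τ (q - τ q • 1) ≤ 1 / 8 := by
    refine hscal q (norm_le_one_of_nonneg_of_le_one hq.nonneg hq.le_one) fun j hj => ?_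
    refine (pow_le_pow_iff_left₀ (l2Norm_nonneg τ _) hδ.le two_ne_zero).mp ?_
    calc l2Norm τ (T j q - q) ^ 2 ≤ min (δ ^ 2) (1 / 4) * (τ q).re := hq.displacement_le ⟨j, hj⟩
      _ ≤ δ ^ 2 * 1 := mul_le_mul (min_le_left _ _) (by linarith) (by linarith) (sq_nonneg δ)
      _ = δ ^ 2 := mul_one _
  have hfar : 1 / 16 ≤ l2Norm τ (q - τ q • 1) ^ 2 := by
    have hdefect : (τ q).re - l2Norm τ q ^ 2 ≤ 1 / 4 * (τ q).re :=
      hq.defect_le.trans (mul_le_mul_of_nonneg_right (min_le_right _ _) (by linarith))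
    rw [h.l2Norm_sub_map_smul_one_sq (.of_nonneg hq.nonneg)]
    nlinarith
  nlinarith [l2Norm_nonneg τ (q - τ q • 1)]

end SpectralGap

/-! ### The weak operator topology and invariant subspaces -/

section WeakOperatorTopology

open ContinuousLinearMapWOT

variable {H : Type*} [NormedAddCommGroup H] [InnerProductSpace ℂ H] [CompleteSpace H]

lemma exists_opNorm_le_of_tendsto_inner {ι : Type*} {l : Filter ι} [l.NeBot] {f : ι → H →L[ℂ] H}
    {b : H → H → ℂ} {C : ℝ} (hC : 0 ≤ C) (hb : ∀ v w, ‖b v w‖ ≤ C * ‖v‖ * ‖w‖)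
    (hlim : ∀ v w, Tendsto (fun i => inner ℂ v (f i w)) l (𝓝 (b v w))) :
    ∃ X : H →L[ℂ] H, ‖X‖ ≤ C ∧ ∀ v w, inner ℂ v (X w) = b v w := by
  let B : H →L⋆[ℂ] H →L[ℂ] ℂ := LinearMap.mkContinuous₂ (LinearMap.mk₂'ₛₗ _ _ b
    (fun v v' w => tendsto_nhds_unique (hlim _ _)
      (by simpa only [inner_add_left] using (hlim v w).add (hlim v' w)))
    (fun c v w => tendsto_nhds_unique (hlim _ _)
      (by simpa only [inner_smul_left, smul_eq_mul] using (hlim v w).const_mul _))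
    (fun v w w' => tendsto_nhds_unique (hlim _ _)
      (by simpa only [map_add, inner_add_right] using (hlim v w).add (hlim v w')))
    (fun c v w => tendsto_nhds_unique (hlim _ _)
      (by simpa only [map_smul, inner_smul_right, RingHom.id_apply, smul_eq_mul]
        using (hlim v w).const_mul c))) C hb
  let X := (InnerProductSpace.continuousLinearMapOfBilin B).adjoint
  have hX : ∀ v w, inner ℂ v (X w) = b v w := fun v w => by
    rw [ContinuousLinearMap.adjoint_inner_right]
    exact InnerProductSpace.continuousLinearMapOfBilin_apply B v w
  refine ⟨X, ContinuousLinearMap.opNorm_le_of_re_inner_le hC fun w v hw hv => ?_, hX⟩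
  calc (inner ℂ (X w) v).re ≤ ‖inner ℂ (X w) v‖ := Complex.re_le_norm _
    _ = ‖b v w‖ := by rw [norm_inner_symm, hX]
    _ ≤ C := by simpa only [hv, hw, mul_one] using hb v w

lemma isCompact_setOf_opNorm_le (C : ℝ) : IsCompact {x : H →WOT[ℂ] H | ‖toCLM x‖ ≤ C} := by
  rw [isCompact_iff_ultrafilter_le_nhds]
  intro 𝒰 h𝒰
  rw [le_principal_iff] at h𝒰
  have hC : 0 ≤ C := by
    obtain ⟨x, hx⟩ := 𝒰.nonempty_of_mem h𝒰
    exact (norm_nonneg _).trans hx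
  have hbound : ∀ v w, ∀ᶠ x in (𝒰 : Filter (H →WOT[ℂ] H)),
      ‖inner ℂ v (toCLM x w)‖ ≤ C * ‖v‖ * ‖w‖ := fun v w => by
    filter_upwards [h𝒰] with x hx
    calc ‖inner ℂ v (toCLM x w)‖ ≤ ‖v‖ * ‖toCLM x w‖ := norm_inner_le_norm _ _
      _ ≤ ‖v‖ * (C * ‖w‖) := by gcongr; exact (toCLM x).le_of_opNorm_le hx w
      _ = C * ‖v‖ * ‖w‖ := by ring
  have hlim : ∀ v w, ∃ z : ℂ, ‖z‖ ≤ C * ‖v‖ * ‖w‖ ∧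
      Tendsto (fun x => inner ℂ v (toCLM x w)) (𝒰 : Filter (H →WOT[ℂ] H)) (𝓝 z) := fun v w => by
    have hdisc : ∀ᶠ z in (𝒰.map fun x => inner ℂ v (toCLM x w) : Filter ℂ),
        z ∈ Metric.closedBall (0 : ℂ) (C * ‖v‖ * ‖w‖) := by
      simpa using hbound v w
    obtain ⟨z, hz, hzlim⟩ := (isCompact_closedBall _ _).ultrafilter_le_nhds _
      (le_principal_iff.2 hdisc)
    exact ⟨z, mem_closedBall_zero_iff.1 hz, hzlim⟩
  choose b hb hblim using hlim
  obtain ⟨X, hXC, hX⟩ := exists_opNorm_le_of_tendsto_inner hC hb hblim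
  refine ⟨ofCLM X, hXC, le_nhds_iff_forall_inner_apply_le_nhds.2 fun w v => ?_⟩
  rw [ofCLM_apply, hX]
  exact hblim v w

omit [CompleteSpace H] in
lemma clm_nonneg_iff_forall_inner_nonneg {T : H →L[ℂ] H} : 0 ≤ T ↔ ∀ v, 0 ≤ inner ℂ v (T v) := by
  rw [ContinuousLinearMap.nonneg_iff_isPositive]
  refine ⟨fun h v => h.inner_nonneg_right v, fun h => ?_⟩
  refine ContinuousLinearMap.isPositive_iff_complex T |>.mpr fun v => ?_
  obtain ⟨hre, him⟩ := Complex.nonneg_iff.mp (h v)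
  rw [← inner_conj_symm v] at hre him
  simp only [Complex.conj_re, Complex.conj_im, zero_eq_neg] at hre him
  exact ⟨Complex.ext rfl him.symm, hre⟩

lemma isClosed_setOf_toCLM_nonneg : IsClosed {x : H →WOT[ℂ] H | 0 ≤ toCLM x} := by
  simp only [clm_nonneg_iff_forall_inner_nonneg, Set.ofPred_forall]
  exact isClosed_iInter fun v => isClosed_le continuous_const
    (continuous_iff.1 continuous_id v v)

lemma isClosed_setOf_le_toCLM (d : H →L[ℂ] H) : IsClosed {x : H →WOT[ℂ] H | d ≤ toCLM x} := by
  simp only [← sub_nonneg (b := d)]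
  exact isClosed_setOf_toCLM_nonneg.preimage (continuous_id.sub (continuous_const (y := ofCLM d)))

lemma isClosed_setOf_toCLM_le (b : H →L[ℂ] H) : IsClosed {x : H →WOT[ℂ] H | toCLM x ≤ b} := by
  simp only [← sub_nonneg (a := b)]
  exact isClosed_setOf_toCLM_nonneg.preimage ((continuous_const (y := ofCLM b)).sub continuous_id)

end WeakOperatorTopology

section VonNeumannAlgebra

open ContinuousLinearMapWOT

variable {H : Type*} [NormedAddCommGroup H] [InnerProductSpace ℂ H] [CompleteSpace H]
  {N : VonNeumannAlgebra H}

lemma mul_comm_of_mem_commutant {x y : H →L[ℂ] H} (hx : x ∈ N) (hy : y ∈ N.commutant) :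
    y * x = x * y :=
  (VonNeumannAlgebra.mem_commutant_iff.1 hy x hx).symm

lemma mem_iff_forall_commutant_mul_comm {x : H →L[ℂ] H} :
    x ∈ N ↔ ∀ y ∈ N.commutant, y * x = x * y := by
  rw [← VonNeumannAlgebra.mem_commutant_iff, N.commutant_commutant]

lemma sqrt_mem {x : H →L[ℂ] H} (hx : x ∈ N) : CFC.sqrt x ∈ N := by
  refine mem_iff_forall_commutant_mul_comm.2 fun y hy => ?_
  have hcomm : Commute x y := (mul_comm_of_mem_commutant hx hy).symm
  exact (hcomm.cfcₙ_nnreal _).symm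

lemma isClosed_setOf_toCLM_mem (N : VonNeumannAlgebra H) :
    IsClosed {x : H →WOT[ℂ] H | toCLM x ∈ N} := by
  have hcomm (y : H →L[ℂ] H) : IsClosed {x : H →WOT[ℂ] H | ofCLM y * x = x * ofCLM y} :=
    isClosed_eq (continuous_const_mul _) (continuous_mul_const _)
  convert isClosed_biInter (s := (N.commutant : Set (H →L[ℂ] H))) fun y _ => hcomm y using 1
  ext x
  simp only [Set.mem_ofPred_eq, Set.mem_iInter, ← toCLM_injective.eq_iff (a := ofCLM _ * x)]
  exact mem_iff_forall_commutant_mul_comm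

lemma isClosed_toStarSubalgebra (N : VonNeumannAlgebra H) :
    IsClosed (N.toStarSubalgebra : Set (H →L[ℂ] H)) := by
  rw [VonNeumannAlgebra.coe_toStarSubalgebra, ← N.centralizer_centralizer]
  exact Set.isClosed_centralizer _

lemma starOrderedRing_toStarSubalgebra (N : VonNeumannAlgebra H) :
    StarOrderedRing N.toStarSubalgebra := by
  refine StarOrderedRing.of_nonneg_iff' (fun {x y} h z => ?_) fun x => ⟨fun h => ?_, ?_⟩
  · exact add_le_add_right (show (x : H →L[ℂ] H) ≤ y from h) (z : H →L[ℂ] H)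
  · refine ⟨⟨CFC.sqrt (x : H →L[ℂ] H), sqrt_mem x.2⟩, Subtype.ext ?_⟩
    change (x : H →L[ℂ] H) = star (CFC.sqrt (x : H →L[ℂ] H)) * CFC.sqrt (x : H →L[ℂ] H)
    rw [(CFC.sqrt_nonneg (x : H →L[ℂ] H)).isSelfAdjoint.star_eq,
      CFC.sqrt_mul_sqrt_self (x : H →L[ℂ] H) h]
  · rintro ⟨s, rfl⟩
    exact star_mul_self_nonneg (s : H →L[ℂ] H)

/-- A supremum is a common point of the weak operator compact sets of those `x` in the unit ball
of `N` which lie between a given `d ∈ D` and all upper bounds of `D`. -/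
theorem exists_isLUB_of_directedOn {D : Set N.toStarSubalgebra} (hne : D.Nonempty)
    (hD : DirectedOn (· ≤ ·) D) (hD1 : ∀ d ∈ D, ‖d‖ ≤ 1) : ∃ a, IsLUB D a := by
  let K (d : N.toStarSubalgebra) : Set (H →WOT[ℂ] H) :=
    {x | ‖toCLM x‖ ≤ 1} ∩ {x | toCLM x ∈ N} ∩ {x | (d : H →L[ℂ] H) ≤ toCLM x} ∩
      ⋂ b ∈ upperBounds D, {x | toCLM x ≤ (b : H →L[ℂ] H)}
  have hclosed (d) : IsClosed (K d) :=
    (((isCompact_setOf_opNorm_le 1).isClosed.inter (isClosed_setOf_toCLM_mem N)).inter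
      (isClosed_setOf_le_toCLM _)).inter (isClosed_biInter fun b _ => isClosed_setOf_toCLM_le _)
  have hcompact (d) : IsCompact (K d) :=
    (isCompact_setOf_opNorm_le 1).of_isClosed_subset (hclosed d) fun _ hx => hx.1.1.1
  have hanti {d d' : N.toStarSubalgebra} (h : d ≤ d') : K d' ⊆ K d := fun x hx =>
    ⟨⟨hx.1.1, le_trans (b := (d' : H →L[ℂ] H)) h hx.1.2⟩, hx.2⟩
  have : Nonempty D := hne.to_subtype
  obtain ⟨x, hx⟩ := IsCompact.nonempty_iInter_of_directed_nonempty_isCompact_isClosed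
    (fun d : D => K d)
    (fun d d' => by
      obtain ⟨c, hc, hdc, hdc'⟩ := hD d d.2 d' d'.2
      exact ⟨⟨c, hc⟩, hanti hdc, hanti hdc'⟩)
    (fun d => ⟨ofCLM d, ⟨⟨hD1 d d.2, d.1.2⟩, le_refl (d : H →L[ℂ] H)⟩,
      Set.mem_iInter₂.2 fun b hb => hb d.2⟩)
    (fun d => hcompact d) (fun d => hclosed d)
  rw [Set.mem_iInter] at hx
  obtain ⟨d₀⟩ := this
  exact ⟨⟨toCLM x, (hx d₀).1.1.2⟩, fun d hd => (hx ⟨d, hd⟩).1.2,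
    fun b hb => Set.mem_iInter₂.1 (hx d₀).2 b hb⟩

section Prime

/-- The closed linear span of `N b H`, the smallest closed `N`-invariant subspace containing the
range of `b`. -/
def cyclicSubspace (b : N.toStarSubalgebra) : Submodule ℂ H :=
  (Submodule.span ℂ (Set.range fun p : N.toStarSubalgebra × H =>
    (p.1 : H →L[ℂ] H) ((b : H →L[ℂ] H) p.2))).topologicalClosure

instance (b : N.toStarSubalgebra) : CompleteSpace (cyclicSubspace b) :=
  (Submodule.isClosed_topologicalClosure _).completeSpace_coe

lemma map_mem_cyclicSubspace {b : N.toStarSubalgebra} {y : H →L[ℂ] H}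
    (hy : y ∈ N ∨ y ∈ N.commutant) {w : H} (hw : w ∈ cyclicSubspace b) :
    y w ∈ cyclicSubspace b := by
  refine map_mem_closure y.continuous hw fun w hw => ?_
  refine Submodule.span_le.2 ?_ hw |> Submodule.mem_comap (f := (y : H →ₗ[ℂ] H)).1
  rintro _ ⟨⟨z, v⟩, rfl⟩
  rcases hy with hy | hy
  · exact Submodule.subset_span ⟨(⟨y, hy⟩ * z, v), rfl⟩
  · exact Submodule.subset_span
      ⟨(z, y v), congr($(mul_comm_of_mem_commutant (z * b).2 hy) v).symm⟩

lemma apply_self_mem_cyclicSubspace (b : N.toStarSubalgebra) (v : H) :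
    (b : H →L[ℂ] H) v ∈ cyclicSubspace b :=
  Submodule.le_topologicalClosure _ (Submodule.subset_span ⟨(1, v), rfl⟩)

lemma apply_eq_zero_of_mem_cyclicSubspace {a b : N.toStarSubalgebra} (h : ∀ y, a * y * b = 0)
    {w : H} (hw : w ∈ cyclicSubspace b) : (a : H →L[ℂ] H) w = 0 := by
  refine Submodule.topologicalClosure_minimal _ (t := (a : H →L[ℂ] H).ker)
    (Submodule.span_le.2 ?_) (a : H →L[ℂ] H).isClosed_ker hw
  rintro _ ⟨⟨y, v⟩, rfl⟩
  exact congr(($(h y) : H →L[ℂ] H) v)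

lemma exists_starProjection_cyclicSubspace_eq_smul (hN : N.IsFactor) (b : N.toStarSubalgebra) :
    ∃ c : ℂ, (cyclicSubspace b).starProjection = c • 1 := by
  have hz : IsStarProjection (cyclicSubspace b).starProjection := isStarProjection_starProjection
  have hr : (cyclicSubspace b).starProjection.range = cyclicSubspace b :=
    Submodule.range_starProjection _
  have hmem : (cyclicSubspace b).starProjection ∈ N := by
    rw [VonNeumannAlgebra.IsStarProjection.mem_iff hz, hr]
    exact fun y hy w hw => map_mem_cyclicSubspace (Or.inr hy) hw
  have hmem' : (cyclicSubspace b).starProjection ∈ N.commutant := by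
    rw [VonNeumannAlgebra.IsStarProjection.mem_iff hz, hr, N.commutant_commutant]
    exact fun y hy w hw => map_mem_cyclicSubspace (Or.inl hy) hw
  obtain ⟨c, hc⟩ := hN ⟨_, hmem⟩ fun y =>
    Subtype.ext (VonNeumannAlgebra.mem_commutant_iff.1 hmem' y y.2)
  exact ⟨c, congrArg Subtype.val hc⟩

theorem eq_zero_or_eq_zero_of_forall_mul_mul_eq_zero (hN : N.IsFactor) {a b : N.toStarSubalgebra}
    (h : ∀ y, a * y * b = 0) : a = 0 ∨ b = 0 := by
  obtain ⟨c, hc⟩ := exists_starProjection_cyclicSubspace_eq_smul hN b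
  rcases eq_or_ne c 0 with rfl | hc0
  · refine Or.inr (Subtype.ext (ContinuousLinearMap.ext fun v => ?_))
    have hfix := Submodule.starProjection_eq_self_iff.2 (apply_self_mem_cyclicSubspace b v)
    rw [hc] at hfix
    simpa using hfix.symm
  · refine Or.inl (Subtype.ext (ContinuousLinearMap.ext fun v => ?_))
    have hzero := apply_eq_zero_of_mem_cyclicSubspace h
      ((cyclicSubspace b).starProjection_apply_mem v)
    rw [hc] at hzero
    simpa [hc0] using hzero

end Prime

end VonNeumannAlgebra

/-! ### Extreme points of the unit ball of a corner -/

section CornerBall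

variable {A : Type*} [NonUnitalNormedRing A] {e f x : A}

/-- The unit ball of the corner `e A f`, for idempotents `e` and `f`. -/
def cornerBall (e f : A) : Set A := {x | ‖x‖ ≤ 1 ∧ e * x * f = x}

lemma left_mul_of_mem_cornerBall (he : IsIdempotentElem e) (hx : x ∈ cornerBall e f) :
    e * x = x := by
  rw [← hx.2, ← mul_assoc, ← mul_assoc, he.eq]

lemma mul_right_of_mem_cornerBall (hf : IsIdempotentElem f) (hx : x ∈ cornerBall e f) :
    x * f = x := by
  rw [← hx.2, mul_assoc, hf.eq]

end CornerBall

section UnitBall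

lemma eq_zero_of_mem_extremePoints {E : Type*} [AddCommGroup E] [Module ℝ E] {C : Set E} {x z : E}
    (hx : x ∈ C.extremePoints ℝ) (hadd : x + z ∈ C) (hsub : x - z ∈ C) : z = 0 := by
  have hmid : x ∈ openSegment ℝ (x + z) (x - z) :=
    ⟨1 / 2, 1 / 2, by norm_num, by norm_num, by norm_num, by module⟩
  simpa using (mem_extremePoints_iff_left.mp hx).2 _ hadd _ hsub hmid

variable {A : Type*} [CStarAlgebra A] [PartialOrder A] [StarOrderedRing A]

lemma norm_le_one_iff_star_mul_self_le_one {x : A} : ‖x‖ ≤ 1 ↔ star x * x ≤ 1 := by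
  rw [← CStarAlgebra.norm_le_one_iff_of_nonneg (star x * x) (star_mul_self_nonneg x),
    CStarRing.norm_star_mul_self, ← sq, sq_le_one_iff₀ (norm_nonneg x)]

lemma norm_add_smul_sub_le_one {x : A} (hx : ‖x‖ ≤ 1) {t : ℝ} (ht : |t| ≤ 1 / 4) :
    ‖x + t • (x - x * star x * x)‖ ≤ 1 := by
  obtain ⟨d, hd⟩ : ∃ d, d = 1 - star x * x := ⟨_, rfl⟩
  have hp : star x * x = 1 - d := by rw [hd, sub_sub_cancel]
  have h0 : 0 ≤ d := by rw [hd, sub_nonneg]; exact norm_le_one_iff_star_mul_self_le_one.1 hx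
  have h1 : d ≤ 1 := by rw [hd]; exact sub_le_self _ (star_mul_self_nonneg x)
  have hs : star d = d := h0.isSelfAdjoint.star_eq
  have hfactor : x + t • (x - x * star x * x) = x * (1 + t • d) := by
    rw [hd]
    simp only [mul_add, mul_sub, mul_one, mul_smul_comm, mul_assoc]
  have hdefect : 1 - star (x * (1 + t • d)) * (x * (1 + t • d)) =
      d * d + (1 - 2 * t - t ^ 2) • (d - d * d) + t ^ 2 • ((1 - d) * d * (1 - d)) := by
    have hstar : star (x * (1 + t • d)) * (x * (1 + t • d)) =
        (1 + t • d) * (star x * x) * (1 + t • d) := by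
      simp only [star_mul, star_add, star_one, star_smul, star_trivial, hs, mul_assoc]
    rw [hstar, hp]
    simp only [mul_add, add_mul, mul_sub, sub_mul, one_mul, mul_one, smul_mul_assoc,
      mul_smul_comm, smul_sub, smul_add, smul_smul, mul_assoc]
    module
  rw [norm_le_one_iff_star_mul_self_le_one, hfactor, ← sub_nonneg, hdefect]
  have hdd : 0 ≤ d * d := by simpa only [hs] using star_mul_self_nonneg d
  have hconj : 0 ≤ (1 - d) * d * (1 - d) := by
    simpa only [star_sub, star_one, hs] using star_left_conjugate_nonneg h0 (1 - d)
  have hcoeff : 0 ≤ 1 - 2 * t - t ^ 2 := by nlinarith [abs_le.1 ht]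
  exact add_nonneg (add_nonneg hdd (smul_nonneg hcoeff (sub_nonneg.2
    (mul_self_le_self_of_le_one h0 h1)))) (smul_nonneg (sq_nonneg t) hconj)

lemma norm_add_le_one_of_orthogonal {x z q : A} (hq : IsStarProjection q)
    (hxq : star x * x + q ≤ 1) (hxz : star x * z = 0) (hzq : z * q = z) (hz : ‖z‖ ≤ 1) :
    ‖x + z‖ ≤ 1 := by
  rw [norm_le_one_iff_star_mul_self_le_one] at hz ⊢
  have hqs : star q = q := hq.isSelfAdjoint.star_eq
  have hzx : star z * x = 0 := by simpa using congrArg star hxz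
  have hzz : star z * z ≤ q := calc
    star z * z = star (z * q) * (z * q) := by rw [hzq]
    _ = star q * (star z * z) * q := by simp only [star_mul, mul_assoc]
    _ ≤ star q * 1 * q := star_left_conjugate_le_conjugate hz q
    _ = q := by rw [mul_one, hqs, hq.isIdempotentElem.eq]
  calc star (x + z) * (x + z) = star x * x + star z * z := by
        simp only [star_add, mul_add, add_mul, hxz, hzx, add_zero, zero_add]
    _ ≤ star x * x + q := by gcongr
    _ ≤ 1 := hxq

variable {e f x : A}

lemma star_mul_self_le_of_mem_cornerBall (hf : IsStarProjection f) (hx : x ∈ cornerBall e f) :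
    star x * x ≤ f := calc
  star x * x = star (x * f) * (x * f) := by rw [mul_right_of_mem_cornerBall hf.isIdempotentElem hx]
  _ = star f * (star x * x) * f := by simp only [star_mul, mul_assoc]
  _ ≤ star f * 1 * f :=
    star_left_conjugate_le_conjugate (norm_le_one_iff_star_mul_self_le_one.1 hx.1) f
  _ = f := by rw [mul_one, hf.isSelfAdjoint.star_eq, hf.isIdempotentElem.eq]

section ExtremePoint

variable (he : IsStarProjection e) (hf : IsStarProjection f)
  (hx : x ∈ (cornerBall e f).extremePoints ℝ)

include he hf hx

lemma mul_star_mul_self_of_mem_extremePoints : x * star x * x = x := by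
  have hex := left_mul_of_mem_cornerBall he.isIdempotentElem hx.1
  have hxf := mul_right_of_mem_cornerBall hf.isIdempotentElem hx.1
  have hcorner (t : ℝ) : e * (x + t • (x - x * star x * x)) * f = x + t • (x - x * star x * x) := by
    simp only [mul_add, add_mul, mul_smul_comm, smul_mul_assoc, mul_sub, sub_mul, ← mul_assoc, hex]
    simp only [mul_assoc, hxf]
  have hmem (t : ℝ) (ht : |t| ≤ 1 / 4) : x + t • (x - x * star x * x) ∈ cornerBall e f :=
    ⟨norm_add_smul_sub_le_one hx.1.1 ht, hcorner t⟩
  have hzero := eq_zero_of_mem_extremePoints hx (hmem (1 / 4) (by norm_num [abs_of_pos]))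
    (by simpa only [neg_smul, ← sub_eq_add_neg] using hmem (-(1 / 4)) (by norm_num [abs_of_pos]))
  rw [smul_eq_zero, or_iff_right (by norm_num), sub_eq_zero] at hzero
  exact hzero.symm

lemma isStarProjection_sub_mul_star_of_mem_extremePoints :
    IsStarProjection (e - x * star x) := by
  have hxx := mul_star_mul_self_of_mem_extremePoints he hf hx
  refine IsStarProjection.sub_of_mul_eq_right ⟨?_, .mul_star_self x⟩ he ?_
  · rw [IsIdempotentElem, ← mul_assoc, hxx]
  · rw [← mul_assoc, left_mul_of_mem_cornerBall he.isIdempotentElem hx.1]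

lemma isStarProjection_sub_star_mul_of_mem_extremePoints :
    IsStarProjection (f - star x * x) := by
  have hxx := mul_star_mul_self_of_mem_extremePoints he hf hx
  refine IsStarProjection.sub_of_mul_eq_left ⟨?_, .star_mul_self x⟩ hf ?_
  · rw [IsIdempotentElem, mul_assoc, ← mul_assoc x, hxx]
  · rw [mul_assoc, mul_right_of_mem_cornerBall hf.isIdempotentElem hx.1]

/-- Adding to `x` an operator from the orthogonal corner does not leave the unit ball. -/
lemma sub_mul_mul_sub_eq_zero_of_mem_extremePoints (y : A) :
    (e - x * star x) * y * (f - star x * x) = 0 := by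
  have hp := isStarProjection_sub_mul_star_of_mem_extremePoints he hf hx
  have hq := isStarProjection_sub_star_mul_of_mem_extremePoints he hf hx
  have hxx := mul_star_mul_self_of_mem_extremePoints he hf hx
  have hex := left_mul_of_mem_cornerBall he.isIdempotentElem hx.1
  have hxf := mul_right_of_mem_cornerBall hf.isIdempotentElem hx.1
  obtain ⟨p, hpe⟩ : ∃ p, p = e - x * star x := ⟨_, rfl⟩
  obtain ⟨q, hqf⟩ : ∃ q, q = f - star x * x := ⟨_, rfl⟩
  rw [← hpe] at hp ⊢
  rw [← hqf] at hq ⊢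
  have hpx : p * x = 0 := by rw [hpe, sub_mul, hex, hxx, sub_self]
  have hxp : star x * p = 0 := by
    simpa only [star_mul, hp.isSelfAdjoint.star_eq, star_zero] using congrArg star hpx
  have hep : e * p = p := by rw [hpe, mul_sub, he.isIdempotentElem.eq, ← mul_assoc, hex]
  have hqq : q * f = q := by rw [hqf, sub_mul, hf.isIdempotentElem.eq, mul_assoc, hxf]
  have hmem (y : A) (hy : ‖p * y * q‖ ≤ 1) : x + p * y * q ∈ cornerBall e f := by
    refine ⟨norm_add_le_one_of_orthogonal hq ?_ ?_ ?_ hy, ?_⟩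
    · rw [hqf, add_sub_cancel]; exact hf.le_one
    · rw [← mul_assoc, ← mul_assoc, hxp, zero_mul, zero_mul]
    · rw [mul_assoc, hq.isIdempotentElem.eq]
    · rw [mul_add, add_mul, hx.1.2, ← mul_assoc, ← mul_assoc, hep, mul_assoc _ q, hqq]
  obtain ⟨c, hc0, hc⟩ : ∃ c : ℝ, c ≠ 0 ∧ ‖p * (c • y) * q‖ ≤ 1 := by
    refine ⟨(‖p * y * q‖ + 1)⁻¹, by positivity, ?_⟩
    rw [mul_smul_comm, smul_mul_assoc, norm_smul, norm_inv, Real.norm_of_nonneg (by positivity),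
      inv_mul_le_one₀ (by positivity)]
    exact le_add_of_nonneg_right zero_le_one
  have hzero := eq_zero_of_mem_extremePoints hx (hmem _ hc) <| by
    simpa only [mul_neg, neg_mul, ← sub_eq_add_neg] using
      hmem (-(c • y)) (by rwa [mul_neg, neg_mul, norm_neg])
  rwa [mul_smul_comm, smul_mul_assoc, smul_eq_zero, or_iff_right hc0] at hzero

end ExtremePoint

end UnitBall

/-! ### The trace of a II₁ factor -/

section FactorTrace

open ContinuousLinearMapWOT

variable {H : Type*} [NormedAddCommGroup H] [InnerProductSpace ℂ H] [CompleteSpace H]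
  {N : VonNeumannAlgebra H} {τ : N.toStarSubalgebra →ₗ[ℂ] ℂ}

attribute [local instance] isClosed_toStarSubalgebra starOrderedRing_toStarSubalgebra

lemma isCompact_ofCLM_image_cornerBall (e f : N.toStarSubalgebra) :
    IsCompact ((fun x : N.toStarSubalgebra => ofCLM (x : H →L[ℂ] H)) '' cornerBall e f) := by
  have hcorner : IsClosed
      {x : H →WOT[ℂ] H | ofCLM (e : H →L[ℂ] H) * x * ofCLM (f : H →L[ℂ] H) = x} :=
    isClosed_eq ((continuous_mul_const _).comp (continuous_const_mul _)) continuous_id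
  convert ((isCompact_setOf_opNorm_le 1).inter_right (isClosed_setOf_toCLM_mem N)).inter_right
    hcorner using 1
  ext x
  constructor
  · rintro ⟨y, ⟨hy, hyc⟩, rfl⟩
    exact ⟨⟨hy, y.2⟩, congrArg (fun z : N.toStarSubalgebra => ofCLM (z : H →L[ℂ] H)) hyc⟩
  · rintro ⟨⟨hx, hxN⟩, hxc⟩
    exact ⟨⟨toCLM x, hxN⟩, ⟨hx, Subtype.ext (congrArg toCLM hxc)⟩, rfl⟩

lemma extremePoints_cornerBall_nonempty (e f : N.toStarSubalgebra) :
    ((cornerBall e f).extremePoints ℝ).Nonempty := by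
  let Φ (x : N.toStarSubalgebra) : H →WOT[ℂ] H := ofCLM (x : H →L[ℂ] H)
  have hinj : Function.Injective Φ := ofCLM_injective.comp Subtype.val_injective
  have hzero : (0 : N.toStarSubalgebra) ∈ cornerBall e f := ⟨by simp, by simp⟩
  obtain ⟨_, ⟨⟨x, hx, rfl⟩, hext⟩⟩ :=
    (isCompact_ofCLM_image_cornerBall e f).extremePoints_nonempty ⟨_, 0, hzero, rfl⟩
  refine ⟨x, mem_extremePoints_iff_left.mpr ⟨hx, fun y hy z hz hxyz => hinj ?_⟩⟩
  obtain ⟨s, t, hs, ht, hst, rfl⟩ := hxyz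
  exact hext ⟨y, hy, rfl⟩ ⟨z, hz, rfl⟩ ⟨s, t, hs, ht, hst, rfl⟩

namespace IsFaithfulNormalTracialState

/-- The trace as a positive functional. -/
noncomputable def toPositiveLinearMap (hτ : IsFaithfulNormalTracialState N τ) :
    N.toStarSubalgebra →ₚ[ℂ] ℂ :=
  PositiveLinearMap.mk₀ τ fun x hx => by
    obtain ⟨y, rfl⟩ := CStarAlgebra.nonneg_iff_eq_star_mul_self.mp hx
    exact hτ.nonneg y

lemma isTracialState (hτ : IsFaithfulNormalTracialState N τ) :
    IsTracialState hτ.toPositiveLinearMap :=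
  ⟨hτ.map_one, hτ.tracial⟩

lemma eq_zero_of_re_eq_zero (hτ : IsFaithfulNormalTracialState N τ) {a : N.toStarSubalgebra}
    (ha : 0 ≤ a) (h : (τ a).re = 0) : a = 0 := by
  obtain ⟨y, rfl⟩ := CStarAlgebra.nonneg_iff_eq_star_mul_self.mp ha
  have him : (τ (star y * y)).im = 0 := (Complex.nonneg_iff.mp (hτ.nonneg y)).2.symm
  rw [hτ.faithful y (Complex.ext h him), star_zero, zero_mul]

/-- Comparison of projections: an extreme point of the unit ball of `e N (1 - e)` is a partial
isometry whose initial projection is `1 - e` or whose final projection is `e`, and in the latter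
case `τ e ≥ 1 / 2` forces the initial projection to be `1 - e` too. -/
lemma exists_star_mul_mul_eq_one_sub (hτ : IsFaithfulNormalTracialState N τ) (hN : N.IsFactor)
    {e : N.toStarSubalgebra} (he : IsStarProjection e) (h2 : 1 / 2 ≤ (τ e).re) :
    ∃ v, ‖v‖ ≤ 1 ∧ star v * e * v = 1 - e := by
  obtain ⟨x, hx⟩ := extremePoints_cornerBall_nonempty e (1 - e)
  refine ⟨x, hx.1.1, ?_⟩
  rw [mul_assoc, left_mul_of_mem_cornerBall he.isIdempotentElem hx.1]
  rcases eq_zero_or_eq_zero_of_forall_mul_mul_eq_zero hN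
    (sub_mul_mul_sub_eq_zero_of_mem_extremePoints he he.one_sub hx) with h | h
  · have hle : star x * x ≤ 1 - e := star_mul_self_le_of_mem_cornerBall he.one_sub hx.1
    have hre : (τ (1 - e - star x * x)).re = 1 - (τ e).re - (τ e).re := by
      rw [map_sub, map_sub, hτ.tracial (star x) x, ← sub_eq_zero.mp h, hτ.map_one,
        Complex.sub_re, Complex.sub_re, Complex.one_re]
    have hnonneg := re_map_nonneg hτ.toPositiveLinearMap (sub_nonneg.mpr hle)
    have hzero := hτ.eq_zero_of_re_eq_zero (sub_nonneg.mpr hle)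
      (le_antisymm (by linarith) hnonneg)
    exact (sub_eq_zero.mp hzero).symm
  · exact (sub_eq_zero.mp h).symm

theorem isFactorTrace (hτ : IsFaithfulNormalTracialState N τ) (hN : N.IsFactor) :
    IsFactorTrace hτ.toPositiveLinearMap where
  toIsTracialState := hτ.isTracialState
  eq_zero_of_re_eq_zero _ := hτ.eq_zero_of_re_eq_zero
  exists_isLUB _ hne hD hD1 := exists_isLUB_of_directedOn hne hD fun d hd =>
    norm_le_one_of_nonneg_of_le_one (hD1 d hd).1 (hD1 d hd).2
  isLUB_re_map := hτ.normal
  exists_star_mul_mul_eq_one_sub _ := hτ.exists_star_mul_mul_eq_one_sub hN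

end IsFaithfulNormalTracialState

end FactorTrace

/-! ### Inner automorphisms and the theorem -/

section InnerAutomorphisms

variable {A : Type u} [CStarAlgebra A]

/-- The family of automorphisms consisting of all inner automorphisms and of a given family `σ`. -/
noncomputable def withInner {ι : Type*} (σ : ι → A ≃⋆ₐ[ℂ] A) : unitary A ⊕ ι → A ≃⋆ₐ[ℂ] A :=
  Sum.elim (fun u => Unitary.conjStarAlgAut ℂ A u) σ

variable [PartialOrder A] [StarOrderedRing A] {τ : A →ₚ[ℂ] ℂ}

lemma IsTracialState.l2Norm_withInner_inl {ι : Type*} (h : IsTracialState τ) (σ : ι → A ≃⋆ₐ[ℂ] A)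
    (u : unitary A) (x : A) :
    l2Norm τ (withInner σ (Sum.inl u) x - x) = l2Norm τ (u * x - x * u) := by
  rw [← h.l2Norm_unitary_conj_sub, withInner, Sum.elim_inl, Unitary.conjStarAlgAut_apply]

lemma IsTracialState.controlsCommutators_withInner {ι : Type*} (h : IsTracialState τ)
    (σ : ι → A ≃⋆ₐ[ℂ] A) : ControlsCommutators τ (withInner σ) := by
  classical
  intro a
  suffices ∃ J : Finset (unitary A ⊕ ι), ∃ C : ℝ, 0 ≤ C ∧ ∀ y,
      l2Norm τ (a * y - y * a) ≤ C * ∑ j ∈ J, l2Norm τ (withInner σ j y - y) by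
    obtain ⟨J, C, -, hJ⟩ := this
    exact ⟨J, C, hJ⟩
  have ha : a ∈ Submodule.span ℂ (unitary A : Set A) :=
    (CStarAlgebra.span_unitary A).symm ▸ Submodule.mem_top
  induction ha using Submodule.span_induction with
  | mem u hu =>
    refine ⟨{Sum.inl ⟨u, hu⟩}, 1, zero_le_one, fun y => ?_⟩
    rw [Finset.sum_singleton, h.l2Norm_withInner_inl, one_mul]
  | zero => exact ⟨∅, 0, le_rfl, fun y => by simp [l2Norm_zero]⟩
  | add a b _ _ iha ihb =>
    obtain ⟨J, C, hC, hJ⟩ := iha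
    obtain ⟨K, D, hD, hK⟩ := ihb
    have hmono (y : A) {s t : Finset (unitary A ⊕ ι)} (hst : s ⊆ t) :
        ∑ j ∈ s, l2Norm τ (withInner σ j y - y) ≤ ∑ j ∈ t, l2Norm τ (withInner σ j y - y) :=
      Finset.sum_le_sum_of_subset_of_nonneg hst fun j _ _ => l2Norm_nonneg τ _
    refine ⟨J ∪ K, C + D, add_nonneg hC hD, fun y => ?_⟩
    rw [add_mul, mul_add, add_sub_add_comm, add_mul C]
    exact (l2Norm_add_le τ _ _).trans <| add_le_add
      ((hJ y).trans (mul_le_mul_of_nonneg_left (hmono y Finset.subset_union_left) hC))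
      ((hK y).trans (mul_le_mul_of_nonneg_left (hmono y Finset.subset_union_right) hD))
  | smul c a _ iha =>
    obtain ⟨J, C, hC, hJ⟩ := iha
    refine ⟨J, ‖c‖ * C, mul_nonneg (norm_nonneg c) hC, fun y => ?_⟩
    rw [smul_mul_assoc, mul_smul_comm, ← smul_sub, l2Norm_smul, mul_assoc]
    exact mul_le_mul_of_nonneg_left (hJ y) (norm_nonneg c)

variable {Λ : Type v} {T : Λ → A ≃⋆ₐ[ℂ] A}

omit [StarOrderedRing A] in
/-- The net is indexed by pairs `(J, n)`, its member at `(J, n)` being moved by at most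
`1 / (n + 1)` by the `T j` with `j ∈ J`. -/
lemma exists_net_of_not_almostFixedAreScalar (hT : ¬ AlmostFixedAreScalar τ T) :
    ∃ ε > 0, ∃ x : Finset Λ × ℕ → A, (∃ C : ℝ, ∀ i, ‖x i‖ ≤ C) ∧
      (∀ j, Tendsto (fun i => l2Norm τ (T j (x i) - x i)) atTop (𝓝 0)) ∧
      ∀ i, ε < l2Norm τ (x i - τ (x i) • 1) := by
  simp only [AlmostFixedAreScalar, not_forall, not_exists, not_and, not_le, exists_prop] at hT
  obtain ⟨ε, hε, C, hT⟩ := hT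
  choose x hxC hxJ hxε using fun i : Finset Λ × ℕ => hT i.1 (1 / ((i.2 : ℝ) + 1)) (by positivity)
  refine ⟨ε, hε, x, ⟨C, hxC⟩, fun j => ?_, hxε⟩
  have hsnd : Tendsto (Prod.snd : Finset Λ × ℕ → ℕ) atTop atTop :=
    prod_atTop_atTop_eq (α := Finset Λ) (β := ℕ) ▸ tendsto_snd
  refine squeeze_zero' (Eventually.of_forall fun i => l2Norm_nonneg τ _) ?_
    (tendsto_one_div_add_atTop_nhds_zero_nat.comp hsnd)
  filter_upwards [eventually_ge_atTop (({j}, 0) : Finset Λ × ℕ)] with i hi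
  exact hxJ i j (hi.1 (Finset.mem_singleton_self j))

omit [StarOrderedRing A] in
lemma ControlsCommutators.tendsto_commutator (hT : ControlsCommutators τ T) {I : Type*}
    {l : Filter I} {x : I → A}
    (hx : ∀ j, Tendsto (fun i => l2Norm τ (T j (x i) - x i)) l (𝓝 0)) (a : A) :
    Tendsto (fun i => l2Norm τ (x i * a - a * x i)) l (𝓝 0) := by
  obtain ⟨J, C, hJ⟩ := hT a
  refine squeeze_zero (fun i => l2Norm_nonneg τ _)
    (fun i => (l2Norm_sub_comm τ _ _).trans_le (hJ (x i))) ?_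
  simpa using (tendsto_finsetSum J fun j _ => hx j).const_mul C

lemma IsTracialState.almostFixedAreScalar_withInner {ι : Type v} (h : IsTracialState τ)
    (σ : ι → A ≃⋆ₐ[ℂ] A)
    (hσ : ∀ (I : Type (max u v)) [Preorder I] [IsDirectedOrder I] [Nonempty I] (x : I → A),
      (∃ C : ℝ, ∀ i, ‖x i‖ ≤ C) →
      (∀ a : A, Tendsto (fun i => l2Norm τ (x i * a - a * x i)) atTop (𝓝 0)) →
      (∀ g : ι, Tendsto (fun i => l2Norm τ (σ g (x i) - x i)) atTop (𝓝 0)) →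
      Tendsto (fun i => l2Norm τ (x i - τ (x i) • 1)) atTop (𝓝 0)) :
    AlmostFixedAreScalar τ (withInner σ) := by
  classical
  by_contra hcon
  obtain ⟨ε, hε, x, hxC, hfix, hfar⟩ := exists_net_of_not_almostFixedAreScalar hcon
  have hscalar := hσ _ x hxC ((h.controlsCommutators_withInner σ).tendsto_commutator hfix)
    fun g => hfix (Sum.inr g)
  obtain ⟨i, hi⟩ := (hscalar.eventually (gt_mem_nhds hε)).exists
  exact (hfar i).not_gt hi

end InnerAutomorphisms

theorem theorem3p1_general {H : Type u} [NormedAddCommGroup H] [InnerProductSpace ℂ H]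
    [CompleteSpace H] (N : VonNeumannAlgebra H) (τ : N.toStarSubalgebra →ₗ[ℂ] ℂ)
    (hN : N.IsFactor) (hτ : IsFaithfulNormalTracialState N τ) {ι : Type v}
    (σ : ι → (N.toStarSubalgebra ≃⋆ₐ[ℂ] N.toStarSubalgebra))
    (hσ : ∀ (I : Type (max u v)) [Preorder I] [IsDirectedOrder I] [Nonempty I]
      (x : I → N.toStarSubalgebra),
      (∃ C : ℝ, ∀ i, ‖x i‖ ≤ C) →
      (∀ a : N.toStarSubalgebra, Tendsto (fun i => twoNorm τ (x i * a - a * x i)) atTop (𝓝 0)) →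
      (∀ g : ι, Tendsto (fun i => twoNorm τ (σ g (x i) - x i)) atTop (𝓝 0)) →
      Tendsto (fun i => twoNorm τ (x i - τ (x i) • 1)) atTop (𝓝 0)) :
    ∃ (S : Finset (unitary N.toStarSubalgebra)) (K : Finset ι) (κ : ℝ), 0 < κ ∧
      ∀ x : N.toStarSubalgebra,
        twoNorm τ (x - τ x • 1) ≤
          κ * (∑ u ∈ S, twoNorm τ ((u : N.toStarSubalgebra) * x - x * u) +
            ∑ g ∈ K, twoNorm τ (σ g x - x)) := by
  have := isClosed_toStarSubalgebra N
  have := starOrderedRing_toStarSubalgebra N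
  have h := hτ.isFactorTrace hN
  obtain ⟨J, κ, hκ, hJ⟩ := h.hasSpectralGap (h.almostFixedAreScalar_withInner σ hσ)
    (h.controlsCommutators_withInner σ)
  refine ⟨J.toLeft, J.toRight, κ, hκ, fun x => ?_⟩
  have hx := hJ x
  rw [← Finset.toLeft_disjSum_toRight (u := J), Finset.sum_disjSum] at hx
  simp only [h.l2Norm_withInner_inl] at hx
  exact hx

theorem theorem3p1 {H : Type u} [NormedAddCommGroup H] [InnerProductSpace ℂ H] [CompleteSpace H]
    (N : VonNeumannAlgebra H) (τ : N.toStarSubalgebra →ₗ[ℂ] ℂ) (hN : IsIIOneFactor N τ)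
    {Γ : Type v} [Group Γ] (σ : Γ →* (N.toStarSubalgebra ≃⋆ₐ[ℂ] N.toStarSubalgebra))
    (hσ : ∀ (I : Type (max u v)) [Preorder I] [IsDirectedOrder I] [Nonempty I]
      (x : I → N.toStarSubalgebra),
      (∃ C : ℝ, ∀ i, ‖x i‖ ≤ C) →
      (∀ a : N.toStarSubalgebra, Tendsto (fun i => twoNorm τ (x i * a - a * x i)) atTop (𝓝 0)) →
      (∀ g : Γ, Tendsto (fun i => twoNorm τ (σ g (x i) - x i)) atTop (𝓝 0)) →
      Tendsto (fun i => twoNorm τ (x i - τ (x i) • 1)) atTop (𝓝 0)) :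
    ∃ (S : Finset (unitary N.toStarSubalgebra)) (K : Finset Γ) (κ : ℝ), 0 < κ ∧
      ∀ x : N.toStarSubalgebra,
        twoNorm τ (x - τ x • 1) ≤
          κ * (∑ u ∈ S, twoNorm τ ((u : N.toStarSubalgebra) * x - x * u) +
            ∑ g ∈ K, twoNorm τ (σ g x - x)) :=
  theorem3p1_general N τ hN.factor hN.trace σ hσ
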